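/- Let $n\ge 0$. The toric arrangement of Coxeter type $A_n$ is the arrangement in the torus $(\mathbb R/\mathbb Z)^n$, with coordinates $x_1,\dots,x_n$, of the hypersurfaces $x_i=0$ ($1\le i\le n$) and $x_i=x_j$ ($1\le i<j\le n$). Its lift to $\mathbb R^n$ is the arrangement of all hyperplanes $x_i=c$ and $x_j-x_i=c$ with $c\in\mathbb Z$; the closed faces of this lift form a polyhedral complex on $\mathbb R^n$, on which $\mathbb Z^n$ acts by translations, and the quotient $K_{A_n}$ is a polyhedral CW complex on the torus: its cells are the $\mathbb Z^n$-orbits of faces, and the characteristic map $P_\alpha\to(\mathbb R/\mathbb Z)^n$ of a cell $\alpha$ is the restriction of the covering map to a closed face $P_\alpha$ representing $\alpha$. The face category $\mathscr F(A_n)$ has the cells of $K_{A_n}$ as objects; its morphisms $\beta\to\alpha$ are the polyhedral homeomorphisms $\varphi$ of $P_\beta$ onto a face of $P_\alpha$ with $\beta=\alpha\circ\varphi$ (as characteristic maps), composed as maps. A cyclic partition of $n$ is a partition of $\{0,\dots,n\}$ together with a cyclic order on its set of blocks. A cyclic partition with $k$ blocks has $k$ separators, one after each block. In the category of cyclic partitions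 of $n$, a morphism $x\to y$, where $x$ has $k$ blocks and $y$ has $h$ blocks, is a set of $h-k$ separators of $y$ whose removal from $y$ leaves $x$ (the blocks on both sides of a removed separator are merged and the cyclic order is inherited). Composition is the union of sets of separators, where the separators of the middle partition are identified with those kept in the target. Then $K_{A_n}$ is a polyhedral CW complex, the category of cyclic partitions of $n$ is acyclic (isomorphisms are endomorphisms and all endomorphisms are identities), and the face category $\mathscr F(A_n)$ is isomorphic to the category of cyclic partitions of $n$. Moreover, for every cyclic partition $y$ with $k$ blocks there are exactly $k$ morphisms from the one-block partition to $y$. -/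

import Mathlib

open CategoryTheory

/-! ### Acyclic categories -/

/-- An acyclic category (small category without loops): the only invertible morphisms are
endomorphisms, and the only endomorphisms are the identities. -/
structure IsAcyclicCategory (C : Type) [SmallCategory C] : Prop where
  eq_of_isIso : ∀ {x y : C} (f : x ⟶ y), IsIso f → x = y
  endo_eq_id : ∀ {x : C} (f : x ⟶ x), f = 𝟙 x

/-! ### Polytopes, polyhedral CW complexes and their face categories -/

section PolyhedralCW

variable {E K : Type} [NormedAddCommGroup E] [NormedSpace ℝ E] [TopologicalSpace K]

/-- A polytope is the convex hull of a nonempty finite set of points. -/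
def IsPolytope (P : Set E) : Prop :=
  ∃ s : Set E, s.Finite ∧ s.Nonempty ∧ P = convexHull ℝ s

/-- A face of `P` is a nonempty set `{x ∈ P | l x = c}` where the linear form `l` satisfies
`l ≥ c` on `P`. -/
def IsPolytopeFace (P F : Set E) : Prop :=
  F.Nonempty ∧ ∃ (l : E →ₗ[ℝ] ℝ) (c : ℝ), (∀ x ∈ P, c ≤ l x) ∧ F = {x ∈ P | l x = c}

/-- `φ : P → Q` is a polyhedral homeomorphism of `P` onto a face of `Q`: it is a homeomorphism
onto its image, and it carries faces (in particular `P` itself) to faces of `Q`. Recall that the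
faces of a face `F` of a polytope `Q` are exactly the faces of `Q` that are contained in `F`. -/
structure IsFaceMap (P Q : Set E) (φ : P → Q) : Prop where
  isEmbedding : Topology.IsEmbedding φ
  image_face : ∀ F : Set E, IsPolytopeFace P F →
    IsPolytopeFace Q {y | ∃ x : P, (x : E) ∈ F ∧ (φ x : E) = y}

variable (E K) in
/-- A family of maps `α : P_α → K` from subsets of `E` to `K`; this is the data underlying a
polyhedral CW complex on `K`. -/
structure CellFamily where
  /-- the indexing set of the cells -/
  Cell : Type
  /-- the polytope of a cell -/
  polytope : Cell → Set E
  /-- the characteristic map of a cell -/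
  char : ∀ α : Cell, polytope α → K

namespace CellFamily

/-- The open cell `F(α)`: the image of the (relative) interior of the polytope. -/
def openCell (X : CellFamily E K) (α : X.Cell) : Set K :=
  X.char α '' {x | (x : E) ∈ intrinsicInterior ℝ (X.polytope α)}

/-- The axioms of a polyhedral CW complex. -/
structure IsPolyhedralCW (X : CellFamily E K) : Prop where
  t2 : T2Space K
  isPolytope : ∀ α, IsPolytope (X.polytope α)
  continuous_char : ∀ α, Continuous (X.char α)
  /-- each characteristic map is a homeomorphism from the interior onto the open cell -/
  homeo_interior : ∀ α, Topology.IsEmbedding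
    (fun x : {x : X.polytope α // (x : E) ∈ intrinsicInterior ℝ (X.polytope α)} => X.char α x)
  /-- `K` is the disjoint union of the open cells -/
  disjointUnion : ∀ p : K, ∃! α, p ∈ X.openCell α
  /-- weak topology -/
  isClosed_iff : ∀ S : Set K, IsClosed S ↔ ∀ α, IsClosed (S ∩ Set.range (X.char α))
  /-- each face `F` of `P_α` is polyhedrally homeomorphic to some `P_β`, compatibly with the
  characteristic maps -/
  face : ∀ (α : X.Cell) (F : Set E), IsPolytopeFace (X.polytope α) F →
    ∃ (β : X.Cell) (φ : X.polytope β → X.polytope α),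
      IsFaceMap (X.polytope β) (X.polytope α) φ ∧
      (∀ x, X.char α (φ x) = X.char β x) ∧ Set.range (fun x => (φ x : E)) = F

/-- The objects of the face category are the cells. -/
def FaceCategory (X : CellFamily E K) : Type := X.Cell

/-- A morphism `β ⟶ α` of the face category is a polyhedral homeomorphism `φ` of `P_β` onto a
face of `P_α` such that `β = α ∘ φ`. -/
@[ext]
structure FaceHom (X : CellFamily E K) (β α : X.Cell) where
  toFun : X.polytope β → X.polytope α
  isFaceMap : IsFaceMap (X.polytope β) (X.polytope α) toFun
  char_comp : ∀ x, X.char α (toFun x) = X.char β x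

instance (X : CellFamily E K) : SmallCategory X.FaceCategory where
  Hom β α := FaceHom X β α
  id α :=
    { toFun := id
      isFaceMap :=
        { isEmbedding := Topology.IsEmbedding.id
          image_face := by
            intro F hF
            have hsub : F ⊆ X.polytope α := by
              obtain ⟨-, l, c, -, rfl⟩ := hF
              exact fun x hx => hx.1
            have : {y | ∃ x : X.polytope α, (x : E) ∈ F ∧ ((id x : X.polytope α) : E) = y} = F := by
              ext y
              constructor
              · rintro ⟨x, hx, rfl⟩
                exact hx
              · intro hy
                exact ⟨⟨y, hsub hy⟩, hy, rfl⟩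
            rw [this]
            exact hF }
      char_comp := fun _ => rfl }
  comp {γ β α} f g :=
    { toFun := g.toFun ∘ f.toFun
      isFaceMap :=
        { isEmbedding := g.isFaceMap.isEmbedding.comp f.isFaceMap.isEmbedding
          image_face := by
            intro F hF
            have h := g.isFaceMap.image_face _ (f.isFaceMap.image_face F hF)
            have he : {y | ∃ x : X.polytope γ, (x : E) ∈ F ∧
                (((g.toFun ∘ f.toFun) x : X.polytope α) : E) = y} =
                {y | ∃ x : X.polytope β, (x : E) ∈
                  {z | ∃ w : X.polytope γ, (w : E) ∈ F ∧ (f.toFun w : E) = z} ∧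
                  (g.toFun x : E) = y} := by
              ext y
              constructor
              · rintro ⟨x, hx, rfl⟩
                exact ⟨f.toFun x, ⟨x, hx, rfl⟩, rfl⟩
              · rintro ⟨x, ⟨w, hw, hwx⟩, rfl⟩
                obtain rfl : f.toFun w = x := Subtype.ext hwx
                exact ⟨w, hw, rfl⟩
            rw [he]
            exact h }
      char_comp := fun x => (g.char_comp _).trans (f.char_comp x) }

end CellFamily

end PolyhedralCW

/-! ### Toric arrangements -/

/-- An (essential) toric arrangement in `(ℝ/ℤ)^d`, given by an integer matrix of full row rank,
whose columns are indexed by a finite set, and by elements `b_j ∈ ℝ/ℤ`. -/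
structure ToricArrangement (d : ℕ) where
  ι : Type
  finite : Finite ι
  matrix : Matrix (Fin d) ι ℤ
  offset : ι → UnitAddCircle
  fullRowRank : LinearIndependent ℤ matrix.row

namespace ToricArrangement

variable {d : ℕ}

/-- The hypersurface `{z | ∑ k, a_{k,j} z_k = b_j}` of the torus (in additive notation). -/
def hypersurface (A : ToricArrangement d) (j : A.ι) : Set (Fin d → UnitAddCircle) :=
  {z | ∑ k, A.matrix k j • z k = A.offset j}

/-- The universal covering map of the torus. -/
def cover (d : ℕ) (x : EuclideanSpace ℝ (Fin d)) : Fin d → UnitAddCircle :=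
  fun k => (x k : UnitAddCircle)

/-- The linear form on `ℝ^d` given by the `j`-th column of the matrix. -/
def form (A : ToricArrangement d) (j : A.ι) (x : EuclideanSpace ℝ (Fin d)) : ℝ :=
  ∑ k, (A.matrix k j : ℝ) * x k

/-- The lift of `H_j` is the union of the hyperplanes `{x | form j x = c}` where `c` ranges over
the real numbers that represent `b_j`. -/
theorem cover_preimage_hypersurface (A : ToricArrangement d) (j : A.ι) :
    cover d ⁻¹' A.hypersurface j =
      ⋃ c ∈ {c : ℝ | (c : UnitAddCircle) = A.offset j}, {x | A.form j x = c} := by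
  ext x
  have h : ((A.form j x : ℝ) : UnitAddCircle) = ∑ k, A.matrix k j • (x k : UnitAddCircle) := by
    simp only [form]
    rw [← QuotientAddGroup.mk'_apply, map_sum]
    refine Finset.sum_congr rfl fun k _ => ?_
    rw [← zsmul_eq_mul, map_zsmul]
    rfl
  simp [hypersurface, cover, h]

/-- Two points of `ℝ^d` lie in the same (relatively open) face of the lifted arrangement if they
lie on the same side of (or both on) each of its hyperplanes. -/
def SameFace (A : ToricArrangement d) (x y : EuclideanSpace ℝ (Fin d)) : Prop :=
  ∀ (j : A.ι) (c : ℝ), (c : UnitAddCircle) = A.offset j →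
    SignType.sign (A.form j x - c) = SignType.sign (A.form j y - c)

/-- The relatively open faces of the lifted arrangement. -/
def LiftedFace (A : ToricArrangement d) : Type :=
  {F : Set (EuclideanSpace ℝ (Fin d)) // ∃ x, F = {y | A.SameFace x y}}

/-- The polyhedral complex `K_{A↑}` on `ℝ^d`: its polytopes are the closed faces of the lifted
arrangement, and its characteristic maps are the inclusions. -/
def liftedComplex (A : ToricArrangement d) :
    CellFamily (EuclideanSpace ℝ (Fin d)) (EuclideanSpace ℝ (Fin d)) where
  Cell := A.LiftedFace
  polytope F := closure F.1
  char _ x := x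

/-- The deck transformation of `ℝ^d` given by `v ∈ ℤ^d`. -/
def deck (v : Fin d → ℤ) (x : EuclideanSpace ℝ (Fin d)) : EuclideanSpace ℝ (Fin d) :=
  x + WithLp.toLp 2 (fun k => (v k : ℝ))

/-- The faces of the lifted arrangement up to deck transformations. -/
def orbitSetoid (A : ToricArrangement d) : Setoid A.LiftedFace where
  r F G := ∃ v : Fin d → ℤ, G.1 = deck v '' F.1
  iseqv :=
    { refl := fun F => ⟨0, by
        have : (deck (0 : Fin d → ℤ)) = id := by
          funext x; ext k; simp [deck]
        rw [this, Set.image_id]⟩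
      symm := by
        rintro F G ⟨v, h⟩
        refine ⟨-v, ?_⟩
        rw [h, ← Set.image_comp]
        have : deck (-v) ∘ deck v = id := by
          funext x; ext k; simp [deck]
        rw [this, Set.image_id]
      trans := by
        rintro F G H ⟨v, h⟩ ⟨w, h'⟩
        refine ⟨v + w, ?_⟩
        rw [h', h, ← Set.image_comp]
        congr 1
        funext x; ext k; simp [deck, add_assoc] }

/-- The quotient complex `K_A = K_{A↑}/ℤ^d` on the torus: its cells are the orbits of cells of
`K_{A↑}`, and the characteristic map of an orbit is the composition of the characteristic map of
a representative with the covering map. -/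
noncomputable def complex (A : ToricArrangement d) :
    CellFamily (EuclideanSpace ℝ (Fin d)) (Fin d → UnitAddCircle) where
  Cell := Quotient A.orbitSetoid
  polytope α := A.liftedComplex.polytope α.out
  char α x := cover d (A.liftedComplex.char α.out x)

/-- The face category of a toric arrangement. -/
abbrev FaceCategory (A : ToricArrangement d) : Type := A.complex.FaceCategory

/-- The toric arrangement of Coxeter type `A_n`: with the convention `x_0 = 0`, the hypersurface
with index `(i, j)`, `0 ≤ i < j ≤ n`, has equation `x_j - x_i = 0`. The coordinate `x_i`, `i ≥ 1`,
is the one with index `i - 1` in `Fin n`. -/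
def coxeterA (n : ℕ) : ToricArrangement n where
  ι := {p : Fin (n + 1) × Fin (n + 1) // p.1 < p.2}
  finite := inferInstance
  matrix := Matrix.of fun k p =>
    (if p.1.2 = k.succ then 1 else 0) - (if p.1.1 = k.succ then 1 else 0)
  offset _ := 0
  fullRowRank := by
    rw [Fintype.linearIndependent_iff]
    intro g hg k
    have := congrFun hg ⟨(0, k.succ), Fin.succ_pos k⟩
    simpa [Finset.sum_apply, Fin.succ_inj, eq_comm (a := (0 : Fin (n + 1))),
      Fin.succ_ne_zero] using this

end ToricArrangement

/-! ### Cyclic partitions -/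

/-- A cyclic partition of `n`: a partition of `{0, …, n}` whose set of blocks is cyclically
ordered. -/
structure CyclicPartition (n : ℕ) where
  rel : Setoid (Fin (n + 1))
  order : CircularOrder (Quotient rel)

namespace CyclicPartition

variable {n : ℕ}

/-- The set of blocks. -/
abbrev Block (x : CyclicPartition n) : Type := Quotient x.rel

instance (x : CyclicPartition n) : CircularOrder x.Block := x.order

/-- A cyclic string with `k ≥ 1` blocks has `k` separators, one at the end of each block: the block
`B` stands for the separator that comes immediately after `B` in the cyclic string. -/
abbrev Separator (x : CyclicPartition n) : Type := x.Block

/-- If `y` refines `x`, the block of `x` that contains a given block of `y`. -/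
def containing {x y : CyclicPartition n} (h : y.rel ≤ x.rel) : y.Block → x.Block :=
  Quotient.map id fun _ _ hij => h hij

/-- A morphism from `x` to `y`: a set of separators of `y` whose removal from `y` leaves `x`.
Each block `B` of `y` whose separator is removed is merged with the blocks that follow it, up to and
including the first block whose separator is kept. Thus the blocks of `x` correspond to the
separators that are kept (in particular, if `x` has `k` blocks and `y` has `h` blocks, then `h - k`
separators are removed), and they inherit their cyclic order. -/
@[ext]
structure Hom (x y : CyclicPartition n) where
  removed : Set y.Separator
  refines : y.rel ≤ x.rel
  /-- each block of `x` contains exactly one block of `y` whose separator is kept -/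
  unique_kept : ∀ X : x.Block, ∃! B : y.Block, B ∉ removed ∧ containing refines B = X
  /-- `B` is merged with the first block `C` after it whose separator is kept -/
  merge : ∀ B ∈ removed, ∃ C ∉ removed,
    containing refines C = containing refines B ∧ ∀ D ∉ removed, btw B C D
  /-- the cyclic order on the blocks of `x` is inherited -/
  btw_iff : ∀ B ∉ removed, ∀ C ∉ removed, ∀ D ∉ removed,
    btw (containing refines B) (containing refines C) (containing refines D) ↔ btw B C D

theorem containing_self {x : CyclicPartition n} (h : x.rel ≤ x.rel) (B : x.Block) :
    containing h B = B := by
  induction B using Quotient.inductionOn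
  rfl

theorem containing_containing {x y z : CyclicPartition n} (h : y.rel ≤ x.rel) (h' : z.rel ≤ y.rel)
    (B : z.Block) : containing h (containing h' B) = containing (h'.trans h) B := by
  induction B using Quotient.inductionOn
  rfl

/-- The empty set of separators. -/
def Hom.id (x : CyclicPartition n) : Hom x x where
  removed := ∅
  refines := le_rfl
  unique_kept X := ⟨X, by simp [containing_self], by simp [containing_self]⟩
  merge B hB := absurd hB (Set.notMem_empty B)
  btw_iff B _ C _ D _ := by simp [containing_self]

/-- Composition is the union of the two sets of separators, where a separator of `y` is identified
with the separator of `z` from which it comes, that is, with the kept separator at the end of the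
last block of `z` in the corresponding block of `y`. -/
def Hom.comp {x y z : CyclicPartition n} (f : Hom x y) (g : Hom y z) : Hom x z where
  removed := g.removed ∪ {B | B ∉ g.removed ∧ containing g.refines B ∈ f.removed}
  refines := g.refines.trans f.refines
  unique_kept X := by
    obtain ⟨C, ⟨hC, hCX⟩, hCu⟩ := f.unique_kept X
    obtain ⟨B, ⟨hB, hBC⟩, hBu⟩ := g.unique_kept C
    refine ⟨B, ⟨?_, ?_⟩, ?_⟩
    · rintro (h | h)
      · exact hB h
      · exact hC (hBC ▸ h.2)
    · rw [← containing_containing f.refines g.refines, hBC, hCX]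
    · rintro B' ⟨hB', hX⟩
      rw [← containing_containing f.refines g.refines] at hX
      have h1 : B' ∉ g.removed := fun h => hB' (Or.inl h)
      have h2 : containing g.refines B' ∉ f.removed := fun h => hB' (Or.inr ⟨h1, h⟩)
      exact hBu B' ⟨h1, hCu _ ⟨h2, hX⟩⟩
  merge := by
    have key : ∀ B, B ∉ g.removed → containing g.refines B ∈ f.removed →
        ∃ C ∉ g.removed ∪ {B | B ∉ g.removed ∧ containing g.refines B ∈ f.removed},
          containing (g.refines.trans f.refines) C = containing (g.refines.trans f.refines) B ∧
          ∀ D ∉ g.removed ∪ {B | B ∉ g.removed ∧ containing g.refines B ∈ f.removed},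
            btw B C D := by
      intro B hB hBf
      obtain ⟨C', hC', hCB, hbtw⟩ := f.merge _ hBf
      obtain ⟨C, ⟨hC, hCC'⟩, -⟩ := g.unique_kept C'
      refine ⟨C, ?_, ?_, ?_⟩
      · rintro (h | h)
        · exact hC h
        · exact hC' (hCC' ▸ h.2)
      · rw [← containing_containing f.refines g.refines, hCC', hCB, containing_containing]
      · intro D hD
        have h1 : D ∉ g.removed := fun h => hD (Or.inl h)
        have h2 : containing g.refines D ∉ f.removed := fun h => hD (Or.inr ⟨h1, h⟩)
        rw [← g.btw_iff B hB C hC D h1, hCC']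
        exact hbtw _ h2
    rintro B (hB | ⟨hB, hBf⟩)
    · obtain ⟨C, hC, hCB, hbtw⟩ := g.merge B hB
      by_cases hCf : containing g.refines C ∈ f.removed
      · obtain ⟨C₂, hC₂, hCC₂, hbtw₂⟩ := key C hC hCf
        refine ⟨C₂, hC₂, ?_, ?_⟩
        · rw [hCC₂, ← containing_containing f.refines g.refines, hCB, containing_containing]
        · intro D hD
          have hDg : D ∉ g.removed := fun h => hD (Or.inl h)
          have h1 := hbtw D hDg
          have h2 := hbtw₂ D hD
          have hBC : B ≠ C := fun h => hC (h ▸ hB)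
          have hBD : B ≠ D := fun h => hDg (h ▸ hB)
          have hCD : C ≠ D := fun h => hD (Or.inr ⟨hDg, h ▸ hCf⟩)
          have hCC₂ : C ≠ C₂ := by
            rintro rfl
            exact hC₂ (Or.inr ⟨hC, hCf⟩)
          by_cases hC₂D : C₂ = D
          · subst hC₂D
            exact (btw_total B C₂ C₂).elim (fun h => h) fun h => h.cyclic_right
          have s1 : sbtw B C D := h1.sbtw_of_not_btw fun h' => by
            rcases btw_antisymm h1 h' with h | h | h
            exacts [hBC h, hCD h, hBD h.symm]
          have s2 : sbtw C C₂ D := h2.sbtw_of_not_btw fun h' => by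
            rcases btw_antisymm h2 h' with h | h | h
            exacts [hCC₂ h, hC₂D h, hCD h.symm]
          exact (s1.trans_left s2).btw
      · refine ⟨C, ?_, ?_, ?_⟩
        · rintro (h | h)
          · exact hC h
          · exact hCf h.2
        · rw [← containing_containing f.refines g.refines, hCB, containing_containing]
        · intro D hD
          exact hbtw D fun h => hD (Or.inl h)
    · exact key B hB hBf
  btw_iff B hB C hC D hD := by
    have h1 : ∀ {B}, B ∉ g.removed ∪ {B | B ∉ g.removed ∧ containing g.refines B ∈ f.removed} →
        B ∉ g.removed := fun h h' => h (Or.inl h')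
    have h2 : ∀ {B}, B ∉ g.removed ∪ {B | B ∉ g.removed ∧ containing g.refines B ∈ f.removed} →
        containing g.refines B ∉ f.removed := fun h h' => h (Or.inr ⟨h1 h, h'⟩)
    simp only [← containing_containing f.refines g.refines]
    rw [f.btw_iff _ (h2 hB) _ (h2 hC) _ (h2 hD), g.btw_iff _ (h1 hB) _ (h1 hC) _ (h1 hD)]

/-- The category of cyclic partitions of `n`. -/
instance : SmallCategory (CyclicPartition n) where
  Hom := Hom
  id := Hom.id
  comp := Hom.comp
  id_comp f := by
    apply Hom.ext
    simp [Hom.comp, Hom.id]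
  comp_id f := by
    apply Hom.ext
    simp [Hom.comp, Hom.id, containing_self]
  assoc f g h := by
    apply Hom.ext
    ext B
    simp only [Hom.comp, Set.mem_union, Set.mem_ofPred_eq, containing_containing]
    tauto

/-- The cyclic partition `01…n|` with a single block. -/
def oneBlock (n : ℕ) : CyclicPartition n where
  rel := ⊤
  order :=
    { btw := fun _ _ _ => True
      sbtw := fun _ _ _ => False
      btw_refl := fun _ => trivial
      btw_cyclic_left := fun _ => trivial
      sbtw_iff_btw_not_btw := by simp
      sbtw_trans_left := fun h => h.elim
      btw_antisymm := fun {a b _} _ _ => Or.inl (by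
        induction a using Quotient.inductionOn
        induction b using Quotient.inductionOn
        exact Quotient.sound trivial)
      btw_total := fun _ _ _ => Or.inl trivial }

end CyclicPartition

/-! Put `x_0 = 0` and record a point `x` of `ℝ^n` by the integers `D i j = ⌊x_j - x_i⌋`. These
satisfy `D i i = 0` and `D i j + D j k ≤ D i k ≤ D i j + D j k + 1`, and conversely every such
`FloorCocycle` comes from a point (`exists_floor_eq`). Two points lie in the same open face of the
lifted arrangement iff their cocycles agree (`sameFace_iff`), and the closed face of `x` is the set
of `y` whose cocycle dominates that of `x` pointwise (`closure_openFace`). So the geometry of the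
faces becomes integer inequalities.

Translation by `v` changes `D` by the coboundary `v_j - v_i`. What remains is the position of the
`x_i` on the circle `ℝ/ℤ`: `i` and `j` coincide iff `D i j + D j i = 0`, and `i, j, k` are in cyclic
order iff `D i j + D j k + D k i ≥ -1`. This is a cyclic partition; it determines `D` up to
coboundary (`exists_shift_of_partition_eq`), and every cyclic partition arises
(`partition_ofPartition`). Hence cells correspond to cyclic partitions.

A face map compatible with the characteristic maps is a deck transformation, because its
displacement is continuous and integral on a connected polytope. A morphism from the cell of `C` to
the cell of `D` is therefore an integral vector `V` with `V 0 = 0` and `D ≤ C.shift V`. Moving from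
the face of `D` to this translate makes points on the circle collide in clusters; the separators
that survive are those after the last block of each cluster, namely the blocks of those `i` with `D
j i = C.shift V j i` for all `j` (`Kept`). The kept separators determine `V`
(`homOfShift_injective`), and every admissible set of separators arises (`exists_homOfShift_eq`),
which is the main combinatorial step.

This gives a fully faithful functor, bijective on objects. Acyclicity of the target turns the
resulting equivalence into an isomorphism of categories. A morphism from the one-block partition
keeps exactly one separator, which gives the count. -/

/-! ### Cyclic partitions: extensionality, acyclicity, morphisms from one block. -/

theorem CircularOrder.ext_btw {α : Type*} (o o' : CircularOrder α)
    (h : ∀ a b c, o.btw a b c ↔ o'.btw a b c) : o = o' := by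
  have hb : o.btw = o'.btw := by
    funext a b c
    exact propext (h a b c)
  have hs : o.sbtw = o'.sbtw := by
    funext a b c
    refine propext (o.sbtw_iff_btw_not_btw.trans (Iff.trans ?_ o'.sbtw_iff_btw_not_btw.symm))
    rw [h, h]
  rcases o with @⟨@⟨@⟨⟨b⟩, ⟨s⟩, _, _, _, _⟩, _⟩, _⟩
  rcases o' with @⟨@⟨@⟨⟨b'⟩, ⟨s'⟩, _, _, _, _⟩, _⟩, _⟩
  cases hb
  cases hs
  rfl

namespace CyclicPartition

variable {n : ℕ}

/-- The block of an element. -/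
abbrev block (x : CyclicPartition n) (i : Fin (n + 1)) : x.Block := Quotient.mk x.rel i

theorem ext_of_btw {x y : CyclicPartition n} (hr : ∀ i j, x.rel i j ↔ y.rel i j)
    (hb : ∀ i j k, btw (x.block i) (x.block j) (x.block k) ↔
      btw (y.block i) (y.block j) (y.block k)) : x = y := by
  obtain ⟨r, o⟩ := x
  obtain ⟨r', o'⟩ := y
  obtain rfl : r = r' := Setoid.ext hr
  obtain rfl : o = o' := by
    refine CircularOrder.ext_btw o o' fun a b c => ?_
    induction a using Quotient.inductionOn
    induction b using Quotient.inductionOn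
    induction c using Quotient.inductionOn
    exact hb _ _ _
  rfl

theorem Hom.removed_eq_empty {x : CyclicPartition n} (f : Hom x x) : f.removed = ∅ := by
  refine Set.eq_empty_iff_forall_notMem.2 fun B hB => ?_
  obtain ⟨C, ⟨hC, hCB⟩, -⟩ := f.unique_kept B
  rw [containing_self] at hCB
  exact hC (hCB ▸ hB)

/-- With refinement in both directions the blocks agree, so the kept block inside each block is that
block itself: nothing is removed and the cyclic order is unchanged. An isomorphism supplies the
second refinement through its inverse. -/
theorem Hom.eq_of_rel_le {x y : CyclicPartition n} (f : Hom x y) (h : x.rel ≤ y.rel) : x = y := by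
  have hr : ∀ i j, x.rel i j ↔ y.rel i j := fun i j => ⟨fun hij => h hij, fun hij => f.refines hij⟩
  have kept : ∀ i, y.block i ∉ f.removed := by
    intro i hi
    obtain ⟨C, ⟨hC, hCB⟩, -⟩ := f.unique_kept (x.block i)
    induction C using Quotient.inductionOn with
    | h j =>
      have hji : y.block j = y.block i := Quotient.sound (h (Quotient.exact hCB))
      exact hC (show y.block j ∈ f.removed by rwa [hji])
  exact ext_of_btw hr fun i j k => f.btw_iff _ (kept i) _ (kept j) _ (kept k)

theorem isAcyclicCategory (n : ℕ) : IsAcyclicCategory (CyclicPartition n) where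
  eq_of_isIso {x y} f _ := Hom.eq_of_rel_le (f : Hom x y) (inv f : Hom y x).refines
  endo_eq_id {x} f := Hom.ext (Hom.removed_eq_empty (f : Hom x x))

theorem oneBlock_block_eq (X Y : (oneBlock n).Block) : X = Y := by
  induction X using Quotient.inductionOn
  induction Y using Quotient.inductionOn
  exact Quotient.sound trivial

/-- The morphism from the one-block partition that keeps a single given separator. -/
def homOfKept (y : CyclicPartition n) (B : y.Block) : Hom (oneBlock n) y where
  removed := {B}ᶜ
  refines := fun _ _ _ => trivial
  unique_kept X := ⟨B, ⟨by simp, oneBlock_block_eq _ _⟩, fun C hC => by simpa using hC.1⟩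
  merge C _ := ⟨B, by simp, oneBlock_block_eq _ _, fun D hD => by
    obtain rfl : D = B := by simpa using hD
    exact (btw_total C D D).elim id fun h => h.cyclic_right⟩
  btw_iff C hC D hD E hE := by
    obtain rfl : C = B := by simpa using hC
    obtain rfl : D = C := by simpa using hD
    obtain rfl : E = D := by simpa using hE
    exact ⟨fun _ => btw_refl _, fun _ => btw_refl _⟩

theorem homOfKept_bijective (y : CyclicPartition n) : Function.Bijective (homOfKept y) := by
  constructor
  · intro B C h
    simpa [homOfKept] using congrArg Hom.removed h
  · intro f
    obtain ⟨B, ⟨hB, -⟩, hu⟩ := f.unique_kept ((oneBlock n).block 0)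
    refine ⟨B, Hom.ext ?_⟩
    ext C
    constructor
    · intro hC
      by_contra hC'
      exact hC (hu C ⟨hC', oneBlock_block_eq _ _⟩)
    · rintro hC rfl
      exact hB hC

theorem card_oneBlock_hom (y : CyclicPartition n) :
    Nat.card (oneBlock n ⟶ y) = Nat.card y.Block :=
  (Nat.card_eq_of_bijective _ (homOfKept_bijective y)).symm

end CyclicPartition

/-! ### Floor cocycles and their cyclic partitions. -/

/-- An integral function `D` on pairs of elements of `{0, …, n}` that behaves like the function
`(i, j) ↦ ⌊x j - x i⌋` of a real vector `x`. -/
structure FloorCocycle (n : ℕ) where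
  val : Fin (n + 1) → Fin (n + 1) → ℤ
  self : ∀ i, val i i = 0
  add_le : ∀ i j k, val i j + val j k ≤ val i k
  le_add : ∀ i j k, val i k ≤ val i j + val j k + 1

namespace FloorCocycle

open CyclicPartition

variable {n : ℕ}

instance : CoeFun (FloorCocycle n) fun _ => Fin (n + 1) → Fin (n + 1) → ℤ := ⟨val⟩

theorem add_swap_le (D : FloorCocycle n) (i j : Fin (n + 1)) : D i j + D j i ≤ 0 := by
  have := D.add_le i j i
  rwa [D.self] at this

theorem le_add_swap (D : FloorCocycle n) (i j : Fin (n + 1)) : -1 ≤ D i j + D j i := by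
  have := D.le_add i j i
  rw [D.self] at this
  omega

/-- The elements `i` and `j` are equivalent if `x j - x i` is an integer. -/
def rel (D : FloorCocycle n) : Setoid (Fin (n + 1)) where
  r i j := D i j + D j i = 0
  iseqv :=
    { refl := fun i => by simp [D.self]
      symm := fun {i j} h => by omega
      trans := fun {i j k} h h' => by
        have h1 := D.add_le i j k
        have h2 := D.add_le k j i
        have h3 := D.add_swap_le i k
        omega }

/-- The cyclic sum of `D` along a triple; it is `0` or `-1` for triples in cyclic order. -/
def triple (D : FloorCocycle n) (i j k : Fin (n + 1)) : ℤ := D i j + D j k + D k i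

/-- `D` is additive along any path through an integral difference, so replacing `i` by an equivalent
`i'` changes `D` by a term that cancels in the cyclic sum. This lets the cyclic order be defined on
representatives. -/
theorem triple_congr (D : FloorCocycle n) {i j k i' j' k' : Fin (n + 1)}
    (hi : D.rel i i') (hj : D.rel j j') (hk : D.rel k k') :
    D.triple i j k = D.triple i' j' k' := by
  have key : ∀ {i j i' j'}, D.rel i i' → D.rel j j' → D i j = D i' j' + D i i' - D j j' := by
    intro i j i' j' (hi : D i i' + D i' i = 0) (hj : D j j' + D j' j = 0)
    have := D.add_le i i' j
    have := D.add_le i' j' j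
    have := D.add_le i' i j'
    have := D.add_le i j j'
    omega
  unfold triple
  rw [key hi hj, key hj hk, key hk hi]
  ring

/-- The cyclic partition given by the position of the numbers `x i` on the circle `ℝ/ℤ`. -/
noncomputable def partition (D : FloorCocycle n) : CyclicPartition n where
  rel := D.rel
  order :=
    { btw := fun A B C => -1 ≤ D.triple A.out B.out C.out
      sbtw := fun A B C => -1 ≤ D.triple A.out B.out C.out ∧ ¬ -1 ≤ D.triple C.out B.out A.out
      btw_refl := fun A => by simp [triple, D.self]
      btw_cyclic_left := fun {A B C} h => by unfold triple at *; omega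
      sbtw_iff_btw_not_btw := Iff.rfl
      sbtw_trans_left := fun {A B C E} h h' => by
        unfold triple at *
        have := D.le_add_swap C.out B.out
        have := D.le_add E.out B.out A.out
        have := D.le_add_swap C.out E.out
        have := D.le_add_swap C.out A.out
        have := D.le_add_swap E.out A.out
        omega
      btw_antisymm := fun {A B C} h h' => by
        have h1 := D.add_swap_le A.out B.out
        have h2 := D.add_swap_le B.out C.out
        have h3 := D.add_swap_le C.out A.out
        have key : ∀ {A B : Quotient D.rel}, D A.out B.out + D B.out A.out = 0 → A = B :=
          fun {A B} h => Quotient.out_equiv_out.1 h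
        unfold triple at h h'
        by_cases hA : D A.out B.out + D B.out A.out = 0
        · exact Or.inl (key hA)
        by_cases hB : D B.out C.out + D C.out B.out = 0
        · exact Or.inr (Or.inl (key hB))
        · exact Or.inr (Or.inr (key (by omega)))
      btw_total := fun A B C => by
        have h1 := D.le_add_swap A.out B.out
        have h2 := D.le_add_swap B.out C.out
        have h3 := D.le_add_swap C.out A.out
        unfold triple
        omega }

theorem block_eq_iff (D : FloorCocycle n) {i j : Fin (n + 1)} :
    D.partition.block i = D.partition.block j ↔ D i j + D j i = 0 :=
  Quotient.eq (r := D.rel)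

theorem partition_btw (D : FloorCocycle n) (i j k : Fin (n + 1)) :
    btw (D.partition.block i) (D.partition.block j) (D.partition.block k) ↔
      -1 ≤ D i j + D j k + D k i := by
  have : btw (D.partition.block i) (D.partition.block j) (D.partition.block k) ↔
      -1 ≤ D.triple (D.partition.block i).out (D.partition.block j).out
        (D.partition.block k).out := Iff.rfl
  have h := D.triple_congr (Quotient.mk_out (s := D.rel) i) (Quotient.mk_out (s := D.rel) j)
    (Quotient.mk_out (s := D.rel) k)
  rw [this]
  exact h ▸ Iff.rfl

/-! ### Every cyclic partition comes from a floor cocycle -/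

/-- The linear preorder obtained by cutting a cyclic partition before the block of `0`. -/
def cutLE (y : CyclicPartition n) (i j : Fin (n + 1)) : Prop :=
  y.block i = y.block 0 ∨
    (y.block j ≠ y.block 0 ∧ btw (y.block 0) (y.block i) (y.block j))

theorem sbtw_of_btw_of_ne {α : Type*} [CircularOrder α] {a b c : α} (h : btw a b c)
    (hab : a ≠ b) (hbc : b ≠ c) (hca : c ≠ a) : sbtw a b c :=
  h.sbtw_of_not_btw fun h' => by
    rcases btw_antisymm h h' with h | h | h
    exacts [hab h, hbc h, hca h]

theorem cutLE_total (y : CyclicPartition n) (i j : Fin (n + 1)) : cutLE y i j ∨ cutLE y j i := by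
  by_cases hi : y.block i = y.block 0
  · exact Or.inl (Or.inl hi)
  by_cases hj : y.block j = y.block 0
  · exact Or.inr (Or.inl hj)
  rcases btw_total (y.block 0) (y.block i) (y.block j) with h | h
  · exact Or.inl (Or.inr ⟨hj, h⟩)
  · exact Or.inr (Or.inr ⟨hi, h.cyclic_right⟩)

theorem cutLE_of_block_eq (y : CyclicPartition n) {i j : Fin (n + 1)}
    (h : y.block i = y.block j) : cutLE y i j := by
  by_cases hi : y.block i = y.block 0
  · exact Or.inl hi
  · refine Or.inr ⟨h ▸ hi, ?_⟩
    rw [h]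
    exact btw_refl_right _ _

theorem block_eq_of_cutLE (y : CyclicPartition n) {i j : Fin (n + 1)} (h : cutLE y i j)
    (h' : cutLE y j i) : y.block i = y.block j := by
  rcases h with h | ⟨hj, h⟩
  · rcases h' with h' | ⟨hi, -⟩
    · rw [h, h']
    · exact absurd h hi
  · rcases h' with h' | ⟨hi, h'⟩
    · exact absurd h' hj
    · rcases btw_antisymm h h'.cyclic_left with e | e | e
      exacts [absurd e.symm hi, e, absurd e hj]

theorem cutLE_trans (y : CyclicPartition n) {i j k : Fin (n + 1)} (h : cutLE y i j)
    (h' : cutLE y j k) : cutLE y i k := by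
  rcases h with hi | ⟨hj, h⟩
  · exact Or.inl hi
  by_cases hi : y.block i = y.block 0
  · exact Or.inl hi
  rcases h' with hj' | ⟨hk, h'⟩
  · exact absurd hj' hj
  refine Or.inr ⟨hk, ?_⟩
  by_cases hij : y.block i = y.block j
  · rwa [hij]
  by_cases hjk : y.block j = y.block k
  · rwa [← hjk]
  exact (sbtw_trans_right (sbtw_of_btw_of_ne h (Ne.symm hi) hij hj)
    (sbtw_of_btw_of_ne h' (Ne.symm hj) hjk hk)).btw

/-- Order in the cut line implies cyclic order; this is how the linear order is read back on the
circle. -/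
theorem btw_of_cutLE (y : CyclicPartition n) {i j k : Fin (n + 1)} (h : cutLE y i j)
    (h' : cutLE y j k) : btw (y.block i) (y.block j) (y.block k) := by
  by_cases hij : y.block i = y.block j
  · rw [hij]
    exact btw_refl_left _ _
  by_cases hjk : y.block j = y.block k
  · rw [hjk]
    exact btw_refl_right _ _
  rcases h' with hj | ⟨hk, h'⟩
  · rcases h with hi | ⟨hj', -⟩
    · exact absurd (hi.trans hj.symm) hij
    · exact absurd hj hj'
  rcases h with hi | ⟨hj, h⟩
  · rwa [hi]
  by_cases hi : y.block i = y.block 0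
  · rwa [hi]
  have h1 := (sbtw_of_btw_of_ne h (Ne.symm hi) hij hj).cyclic_right
  have h2 := (sbtw_of_btw_of_ne h' (Ne.symm hj) hjk hk).cyclic_left
  exact (sbtw_trans_right h2 h1).btw.cyclic_right

open Classical in
/-- The floor cocycle with values in `{0, -1}` obtained by cutting a cyclic partition before the
block of `0`. -/
noncomputable def ofPartition (y : CyclicPartition n) : FloorCocycle n where
  val i j := if cutLE y i j then 0 else -1
  self i := if_pos (cutLE_of_block_eq y rfl)
  add_le i j k := by
    have := @cutLE_trans n y i j k
    split_ifs <;> simp_all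
  le_add i j k := by
    have h1 := @cutLE_trans n y k j i
    have h2 := @cutLE_trans n y i k j
    have h3 := cutLE_total y i j
    have h4 := cutLE_total y j k
    split_ifs <;> simp_all

/-- The cyclic sum of a triple is minus the number of its descents in the cut order, so it is at
least `-1` iff at most one descent occurs, which is exactly cyclic order. -/
theorem partition_ofPartition (y : CyclicPartition n) : (ofPartition y).partition = y := by
  have val_eq : ∀ i j, (cutLE y i j ∧ ofPartition y i j = 0) ∨
      (¬ cutLE y i j ∧ ofPartition y i j = -1) := by
    intro i j
    by_cases h : cutLE y i j <;> simp [ofPartition, h]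
  refine ext_of_btw (fun i j => ?_) fun i j k => ?_
  · have h : (ofPartition y).partition.rel i j ↔ ofPartition y i j + ofPartition y j i = 0 :=
      Iff.rfl
    rw [h]
    constructor
    · intro h
      refine Quotient.exact (block_eq_of_cutLE y ?_ ?_)
      · rcases val_eq i j with h1 | h1 <;> rcases val_eq j i with h2 | h2 <;>
          first | omega | exact h1.1
      · rcases val_eq i j with h1 | h1 <;> rcases val_eq j i with h2 | h2 <;>
          first | omega | exact h2.1
    · intro h
      have h : y.block i = y.block j := Quotient.sound h
      have h1 := cutLE_of_block_eq y h
      have h2 := cutLE_of_block_eq y h.symm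
      rcases val_eq i j with h3 | h3
      · rcases val_eq j i with h4 | h4
        · omega
        · exact absurd h2 h4.1
      · exact absurd h1 h3.1
  · rw [partition_btw]
    -- Two consecutive descents put the triple strictly in the reverse cyclic order. The remaining
    -- cases are rotations of this one.
    have strict : ∀ {i j k}, ¬ cutLE y i j → ¬ cutLE y j k →
        ¬ btw (y.block i) (y.block j) (y.block k) := by
      intro i j k h h' hb
      have h1 := (cutLE_total y i j).resolve_left h
      have h2 := (cutLE_total y j k).resolve_left h'
      rcases btw_antisymm hb (btw_of_cutLE y h2 h1) with e | e | e
      · exact h (cutLE_of_block_eq y e)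
      · exact h' (cutLE_of_block_eq y e)
      · exact h (cutLE_trans y (cutLE_of_block_eq y e.symm) h2)
    constructor
    · intro h
      rcases val_eq i j with h1 | h1
      · rcases val_eq j k with h2 | h2
        · exact btw_of_cutLE y h1.1 h2.1
        · rcases val_eq k i with h3 | h3
          · exact (btw_of_cutLE y h3.1 h1.1).cyclic_left
          · omega
      · rcases val_eq j k with h2 | h2
        · rcases val_eq k i with h3 | h3
          · exact (btw_of_cutLE y h2.1 h3.1).cyclic_right
          · omega
        · rcases val_eq k i with h3 | h3 <;> omega
    · intro h
      by_contra hn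
      rcases val_eq i j with h1 | h1
      · rcases val_eq j k with h2 | h2
        · rcases val_eq k i with h3 | h3 <;> omega
        · rcases val_eq k i with h3 | h3
          · omega
          · exact strict h2.1 h3.1 h.cyclic_left
      · rcases val_eq j k with h2 | h2
        · rcases val_eq k i with h3 | h3
          · omega
          · exact strict h3.1 h1.1 h.cyclic_right
        · exact strict h1.1 h2.1 h

/-- `D 0 i` must be the integral part of `x i`, and `D` then prescribes only the weak order of the
fractional parts. Any numbers in `[0, 1)` in this order will do, for example normalized ranks. -/
theorem exists_floor_eq (D : FloorCocycle n) :
    ∃ x : Fin (n + 1) → ℝ, x 0 = 0 ∧ ∀ i j, ⌊x j - x i⌋ = D i j := by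
  classical
  -- The would-be floor of the difference of fractional parts; the value `-1` says that `j` has the
  -- smaller one. Thus `s i` below is the set of elements strictly before `i`.
  let E : Fin (n + 1) → Fin (n + 1) → ℤ := fun i j => D i j - D 0 j + D 0 i
  have hE : ∀ i j, E i j = 0 ∨ E i j = -1 := by
    intro i j
    have := D.add_le 0 i j
    have := D.le_add 0 i j
    simp only [E]
    omega
  let s : Fin (n + 1) → Finset (Fin (n + 1)) := fun i => {k | E i k = -1}
  have mono : ∀ i j, E i j = 0 → s i ⊆ s j := by
    intro i j hij k hk
    simp only [s, Finset.mem_filter_univ] at hk ⊢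
    have := hE j k
    have := D.add_le i j k
    simp only [E] at *
    omega
  have strict : ∀ i j, E i j = -1 → s j ⊂ s i := by
    intro i j hij
    have h1 := hE j i
    have h2 := D.le_add_swap i j
    refine Finset.ssubset_iff_of_subset (mono j i (by simp only [E] at *; omega)) |>.2
      ⟨j, ?_, ?_⟩
    · simpa [s] using hij
    · simp [s, E, D.self]
  have hs0 : s 0 = ∅ := by
    ext k
    simp [s, E, D.self]
  -- The rank is at most `n + 1`, so dividing by `n + 2` keeps it below `1`.
  have hn : (0 : ℝ) < n + 2 := by positivity
  have bound : ∀ i, ((s i).card : ℝ) / (n + 2) < 1 := by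
    intro i
    rw [div_lt_one hn]
    have h := Finset.card_le_univ (s i)
    rw [Fintype.card_fin] at h
    have : ((s i).card : ℝ) ≤ n + 1 := by exact_mod_cast h
    linarith
  have nonneg : ∀ i, 0 ≤ ((s i).card : ℝ) / (n + 2) := fun i => by positivity
  refine ⟨fun i => D 0 i + (s i).card / (n + 2), by simp [D.self, hs0], fun i j => ?_⟩
  have hij : D i j = E i j + D 0 j - D 0 i := by simp only [E]; ring
  rw [hij, Int.floor_eq_iff]
  have b1 := bound i
  have b2 := bound j
  have b3 := nonneg i
  have b4 := nonneg j
  rcases hE i j with h | h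
  · have : ((s i).card : ℝ) / (n + 2) ≤ ((s j).card : ℝ) / (n + 2) := by
      have := Finset.card_le_card (mono i j h)
      gcongr
    rw [h]
    push_cast
    constructor <;> linarith
  · have : ((s j).card : ℝ) / (n + 2) < ((s i).card : ℝ) / (n + 2) := by
      have := Finset.card_lt_card (strict i j h)
      gcongr
    rw [h]
    push_cast
    constructor <;> linarith

/-- The defect `D 0 i + D i j - D 0 j` is the cyclic sum of `0, i, j` minus `D 0 j + D j 0`;
coincidences and cyclic order determine it. Equality of defects is the claimed formula for `V j = D'
0 j - D 0 j`. -/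
theorem exists_shift_of_partition_eq (D D' : FloorCocycle n) (h : D.partition = D'.partition) :
    ∃ V : Fin (n + 1) → ℤ, V 0 = 0 ∧ ∀ i j, D' i j = D i j + V j - V i := by
  have hr : ∀ i j, D i j + D j i = 0 ↔ D' i j + D' j i = 0 := by
    intro i j
    rw [← block_eq_iff, ← block_eq_iff, h]
  have hb : ∀ i j k, -1 ≤ D i j + D j k + D k i ↔ -1 ≤ D' i j + D' j k + D' k i := by
    intro i j k
    rw [← partition_btw, ← partition_btw, h]
  refine ⟨fun j => D' 0 j - D 0 j, by simp [D.self, D'.self], fun i j => ?_⟩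
  have := hr i j
  have := hr 0 i
  have := hr 0 j
  have := hb 0 i j
  have h1 : ∀ D : FloorCocycle n, D 0 i + D i j ≤ D 0 j ∧ D 0 j ≤ D 0 i + D i j + 1 ∧
      D 0 i + D i 0 ≤ 0 ∧ -1 ≤ D 0 i + D i 0 ∧ D 0 j + D j 0 ≤ 0 ∧ -1 ≤ D 0 j + D j 0 ∧
      D i j + D j i ≤ 0 ∧ -1 ≤ D i j + D j i := fun D =>
    ⟨D.add_le _ _ _, D.le_add _ _ _, D.add_swap_le _ _, D.le_add_swap _ _, D.add_swap_le _ _,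
      D.le_add_swap _ _, D.add_swap_le _ _, D.le_add_swap _ _⟩
  have := h1 D
  have := h1 D'
  have := D.add_le i 0 j
  have := D.add_le j 0 i
  have := D'.add_le i 0 j
  have := D'.add_le j 0 i
  have := D.add_le j i 0
  have := D'.add_le j i 0
  have := D.add_le 0 j i
  have := D'.add_le 0 j i
  have := D.add_le i j 0
  have := D'.add_le i j 0
  dsimp only
  omega

end FloorCocycle

/-! ### Degenerations of floor cocycles as morphisms of cyclic partitions. -/

namespace FloorCocycle

open CyclicPartition

variable {n : ℕ}

/-- The floor cocycle of the translate of a point by an integral vector. -/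
def shift (D : FloorCocycle n) (V : Fin (n + 1) → ℤ) : FloorCocycle n where
  val i j := D i j + V j - V i
  self i := by simp [D.self]
  add_le i j k := by
    have := D.add_le i j k
    omega
  le_add i j k := by
    have := D.le_add i j k
    omega

theorem shift_apply (D : FloorCocycle n) (V : Fin (n + 1) → ℤ) (i j : Fin (n + 1)) :
    D.shift V i j = D i j + V j - V i := rfl

/-- The element `i` ends a block whose separator is kept when the point of `D` moves to the point
of `C`. -/
def Kept (D C : FloorCocycle n) (i : Fin (n + 1)) : Prop := ∀ j, D j i = C j i

section Degeneration

variable {D C : FloorCocycle n}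

/-- Here `C i j + C j i = -1` is already the least value possible for `D`, so neither term can have
grown: `D` and `C` differ only within clusters of `C`. -/
theorem eq_of_not_rel (h : ∀ i j, D i j ≤ C i j) {i j : Fin (n + 1)} (hij : C i j + C j i ≠ 0) :
    D i j = C i j := by
  have := C.add_swap_le i j
  have := D.le_add_swap i j
  have := h i j
  have := h j i
  omega

theorem rel_of_rel (h : ∀ i j, D i j ≤ C i j) {i j : Fin (n + 1)} (hij : D i j + D j i = 0) :
    C i j + C j i = 0 := by
  have := C.add_swap_le i j
  have := h i j
  have := h j i
  omega

theorem le_add_one (h : ∀ i j, D i j ≤ C i j) (i j : Fin (n + 1)) : C i j ≤ D i j + 1 := by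
  have := C.add_swap_le i j
  have := D.le_add_swap i j
  have := h j i
  omega

theorem Kept.congr (h : ∀ i j, D i j ≤ C i j) {i j : Fin (n + 1)} (hij : D i j + D j i = 0)
    (hi : Kept D C i) :
    Kept D C j := by
  intro k
  have := hi k
  have := rel_of_rel h hij
  have := h i j
  have := h j i
  have := D.add_le k i j
  have := D.add_le k j i
  have := C.add_le k i j
  have := C.add_le k j i
  omega

/-- Each cluster has a last element. If `m` is not kept, some `j` of its cluster lies ahead of it,
that is `D j m < C j m`, and passing to `j` strictly lowers the total growth `f`; the descent stops
at a kept element. -/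
theorem exists_kept (h : ∀ i j, D i j ≤ C i j) (i : Fin (n + 1)) :
    ∃ m, C i m + C m i = 0 ∧ Kept D C m := by
  let f : Fin (n + 1) → ℕ := fun m => ∑ k, (C k m - D k m).toNat
  have : ∀ (N : ℕ) (m : Fin (n + 1)), f m = N → C i m + C m i = 0 →
      ∃ m, C i m + C m i = 0 ∧ Kept D C m := by
    intro N
    induction N using Nat.strong_induction_on with
    | _ N ih =>
      intro m hm him
      by_cases hk : Kept D C m
      · exact ⟨m, him, hk⟩
      simp only [Kept, not_forall] at hk
      obtain ⟨j, hj⟩ := hk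
      have hjm : C j m + C m j = 0 := by
        by_contra hne
        exact hj (eq_of_not_rel h hne)
      have hlt : f j < f m := by
        refine Finset.sum_lt_sum (fun k _ => ?_) ⟨j, Finset.mem_univ _, ?_⟩
        · have := h k m
          have := h j m
          have := D.le_add k j m
          have := C.add_le k j m
          have := C.add_le k m j
          omega
        · have := h j m
          rw [C.self, D.self]
          omega
      refine ih _ (hm ▸ hlt) j rfl ?_
      have := C.add_le i m j
      have := C.add_le j m i
      have := C.add_swap_le i j
      omega
  exact this _ i rfl (by simp [C.self])

theorem rel_of_kept {i j : Fin (n + 1)} (hi : Kept D C i) (hj : Kept D C j)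
    (hij : C i j + C j i = 0) : D i j + D j i = 0 := by
  rw [hi j, hj i, hij]

/-- This is the merging condition: going around from `i`, no kept `d` is met before the last element
`m` of the cluster of `i`. Keptness replaces `D i m + D m d` by `C i d`, leaving a bound on `D d i`.
-/
theorem triple_of_kept (h : ∀ i j, D i j ≤ C i j) {i m d : Fin (n + 1)}
    (hm : Kept D C m) (hd : Kept D C d)
    (him : C i m + C m i = 0) : -1 ≤ D i m + D m d + D d i := by
  have h1 := hm i
  have h2 := hd m
  have := C.add_le i m d
  have := C.add_le m i d
  have := C.le_add_swap i d
  by_cases hid : C d i + C i d = 0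
  · have := le_add_one h d i
    omega
  · have := eq_of_not_rel h hid
    omega

theorem block_mem_iff (h : ∀ i j, D i j ≤ C i j) (i : Fin (n + 1)) :
    (∃ j, D.partition.block j = D.partition.block i ∧ ¬ Kept D C j) ↔ ¬ Kept D C i := by
  constructor
  · rintro ⟨j, hj, hk⟩ hi
    rw [eq_comm, block_eq_iff] at hj
    exact hk (Kept.congr h hj hi)
  · exact fun hi => ⟨i, rfl, hi⟩

end Degeneration

theorem kept_trans {D C B : FloorCocycle n} (h : ∀ i j, D i j ≤ C i j) (h' : ∀ i j, C i j ≤ B i j)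
    (i : Fin (n + 1)) : Kept D B i ↔ Kept D C i ∧ Kept C B i := by
  constructor
  · intro hk
    constructor <;> intro j <;> have := hk j <;> have := h j i <;> have := h' j i <;> omega
  · rintro ⟨h1, h2⟩ j
    rw [h1 j, h2 j]

/-- The morphism of cyclic partitions associated with a translate of a point in a closed face. -/
def homOfShift (D C : FloorCocycle n) (V : Fin (n + 1) → ℤ)
    (h : ∀ i j, D i j ≤ C.shift V i j) : Hom C.partition D.partition where
  removed := {B | ∃ i, D.partition.block i = B ∧ ¬ Kept D (C.shift V) i}
  refines := by
    intro i j hij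
    have := rel_of_rel h hij
    simp only [shift_apply] at this
    change C i j + C j i = 0
    omega
  unique_kept := by
    intro X
    induction X using Quotient.inductionOn with
    | h i =>
      obtain ⟨m, him, hm⟩ := exists_kept h i
      refine ⟨D.partition.block m, ⟨?_, ?_⟩, ?_⟩
      · rw [Set.mem_ofPred_eq, block_mem_iff h, not_not]
        exact hm
      · refine C.block_eq_iff.2 (show C m i + C i m = 0 from ?_)
        simp only [shift_apply] at him
        omega
      · rintro B ⟨hB, hBi⟩
        induction B using Quotient.inductionOn with
        | h j =>
          have hj : Kept D (C.shift V) j := by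
            by_contra hj
            exact hB ((block_mem_iff h j).2 hj)
          have hji : C j i + C i j = 0 := C.block_eq_iff.1 hBi
          refine D.block_eq_iff.2 (rel_of_kept hj hm ?_)
          have := (C.shift V).add_le j i m
          have := (C.shift V).add_le m i j
          have := (C.shift V).add_swap_le j m
          simp only [shift_apply] at *
          omega
  merge := by
    intro B hB
    induction B using Quotient.inductionOn with
    | h i =>
      obtain ⟨m, him, hm⟩ := exists_kept h i
      refine ⟨D.partition.block m, ?_, ?_, ?_⟩
      · rw [Set.mem_ofPred_eq, block_mem_iff h, not_not]
        exact hm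
      · refine C.block_eq_iff.2 (show C m i + C i m = 0 from ?_)
        simp only [shift_apply] at him
        omega
      · intro E hE
        induction E using Quotient.inductionOn with
        | h d =>
          have hd : Kept D (C.shift V) d := by
            by_contra hd
            exact hE ((block_mem_iff h d).2 hd)
          exact (D.partition_btw i m d).2 (triple_of_kept h hm hd him)
  btw_iff := by
    have key : ∀ i, D.partition.block i ∉
        {B | ∃ i, D.partition.block i = B ∧ ¬ Kept D (C.shift V) i} → Kept D (C.shift V) i := by
      intro i hi
      by_contra hi'
      exact hi ((block_mem_iff h i).2 hi')
    intro B hB B' hB' B'' hB''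
    induction B using Quotient.inductionOn with
    | h i =>
    induction B' using Quotient.inductionOn with
    | h j =>
    induction B'' using Quotient.inductionOn with
    | h k =>
      refine (C.partition_btw i j k).trans (Iff.trans ?_ (D.partition_btw i j k).symm)
      rw [key j hB' i, key k hB'' j, key i hB k]
      simp only [shift_apply]
      constructor <;> intro <;> omega

theorem block_notMem_homOfShift (D C : FloorCocycle n) (V : Fin (n + 1) → ℤ)
    (h : ∀ i j, D i j ≤ C.shift V i j) (i : Fin (n + 1)) :
    D.partition.block i ∉ (homOfShift D C V h).removed ↔ Kept D (C.shift V) i :=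
  (not_congr (block_mem_iff h i)).trans not_not

/-- One common kept `k` suffices: `D j k = C j k + V k - V j` for all `j` determines `V` up to a
constant, and the value at `0` fixes the constant. -/
theorem homOfShift_injective (D C : FloorCocycle n) (V V' : Fin (n + 1) → ℤ)
    (h : ∀ i j, D i j ≤ C.shift V i j) (h' : ∀ i j, D i j ≤ C.shift V' i j) (h0 : V 0 = V' 0)
    (he : homOfShift D C V h = homOfShift D C V' h') : V = V' := by
  obtain ⟨k, -, hk⟩ := exists_kept h 0
  have hk' : Kept D (C.shift V') k := by
    rwa [← block_notMem_homOfShift D C V' h', ← he, block_notMem_homOfShift]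
  funext j
  have h1 := hk j
  have h2 := hk' j
  have h3 := hk 0
  have h4 := hk' 0
  simp only [shift_apply] at *
  omega

/-- In `D ≤ C.shift V ≤ B.shift U` the outer terms agree at a pair iff both inequalities are
equalities there, so an element is kept by the composite iff it is kept at both stages. -/
theorem homOfShift_comp (D C B : FloorCocycle n) (V W U : Fin (n + 1) → ℤ)
    (h : ∀ i j, D i j ≤ C.shift V i j) (h' : ∀ i j, C i j ≤ B.shift W i j)
    (h'' : ∀ i j, D i j ≤ B.shift U i j) (hU : ∀ i, U i = V i + W i) :
    homOfShift D B U h'' = (homOfShift C B W h').comp (homOfShift D C V h) := by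
  apply Hom.ext
  ext X
  induction X using Quotient.inductionOn with
  | h i =>
    rw [← not_iff_not]
    refine (block_notMem_homOfShift D B U h'' i).trans ?_
    have h1 := block_notMem_homOfShift D C V h i
    have h2 := block_notMem_homOfShift C B W h' i
    have h3 : Kept D (B.shift U) i ↔ Kept D (C.shift V) i ∧ Kept C (B.shift W) i := by
      have hle : ∀ i j, C.shift V i j ≤ B.shift U i j := fun i j => by
        have := h' i j
        have := hU i
        have := hU j
        simp only [shift_apply] at *
        omega
      rw [kept_trans h hle]
      refine and_congr_right fun _ => forall_congr' fun j => ?_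
      have := hU i
      have := hU j
      simp only [shift_apply]
      constructor <;> intro <;> omega
    rw [h3, ← h1, ← h2]
    have : containing (homOfShift D C V h).refines (D.partition.block i) =
      C.partition.block i := rfl
    simp only [Hom.comp, Set.mem_union, Set.mem_ofPred_eq, not_or, not_and]
    change _ ↔ _ ∧ (_ → C.partition.block i ∉ _)
    tauto

/-- A single kept `k` forces `V`. The inequality `D ≤ C.shift V` then says that the defect at `(i,
j, k)` does not decrease from `D` to `C`, and keptness of `i` says that the defect at `(j, i, k)` is
unchanged. Both follow by moving each element to the last block of its cluster, where `f` preserves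
cyclic order. -/
theorem exists_homOfShift_eq (D C : FloorCocycle n) (f : Hom C.partition D.partition) :
    ∃ (V : Fin (n + 1) → ℤ) (h : ∀ i j, D i j ≤ C.shift V i j),
      V 0 = 0 ∧ homOfShift D C V h = f := by
  let K : Fin (n + 1) → Prop := fun i => D.partition.block i ∉ f.removed
  have hR : ∀ i j, D i j + D j i = 0 → C i j + C j i = 0 := fun i j hij => f.refines hij
  have hU : ∀ i j, K i → K j → C i j + C j i = 0 → D i j + D j i = 0 := by
    intro i j hi hj hij
    refine D.block_eq_iff.1 ((f.unique_kept (C.partition.block i)).unique ⟨hi, rfl⟩ ⟨hj, ?_⟩)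
    exact C.block_eq_iff.2 (show C j i + C i j = 0 by omega)
  have hT : ∀ i j k, K i → K j → K k →
      (-1 ≤ C i j + C j k + C k i ↔ -1 ≤ D i j + D j k + D k i) := by
    intro i j k hi hj hk
    rw [← partition_btw, ← partition_btw]
    exact f.btw_iff _ hi _ hj _ hk
  have hM : ∀ i, ∃ m, K m ∧ C i m + C m i = 0 ∧
      ∀ d, K d → -1 ≤ D i m + D m d + D d i := by
    intro i
    by_cases hi : K i
    · refine ⟨i, hi, by simp [C.self], fun d _ => ?_⟩
      have := D.le_add_swap i d
      rw [D.self]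
      omega
    · obtain ⟨M, hM, hMi, hbtw⟩ := f.merge _ (not_not.1 hi)
      induction M using Quotient.inductionOn with
      | h m =>
        refine ⟨m, hM, C.block_eq_iff.1 hMi.symm, fun d hd => ?_⟩
        exact (D.partition_btw i m d).1 (hbtw _ hd)
  obtain ⟨k, hk, -⟩ := hM 0
  -- the value `0` or `-1` of the defect at `(i, j, k)` is monotone
  have claim : ∀ i j, D i j + D j k - D i k ≤ C i j + C j k - C i k := by
    intro i j
    obtain ⟨i', hi', hii', hi''⟩ := hM i
    obtain ⟨j', hj', hjj', hj''⟩ := hM j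
    by_contra hlt
    have q1 := C.le_add i j k
    have q2 := D.add_le i j k
    have q3 := D.le_add i j k
    have q4 := C.add_le i j k
    have pC1 := C.le_add_swap i j
    have pC2 := C.add_swap_le i j
    have p1 := D.add_swap_le i k
    have p2 := D.le_add_swap i k
    have p3 := D.add_swap_le j k
    have p4 := D.le_add_swap j k
    have p5 := D.add_swap_le j' k
    have p6 := D.le_add_swap j' k
    have r1 := hR i j
    have r2 := hR i k
    have r3 := hR j k
    -- If `i` and `k` share a cluster, they have the same last block, so `k` replaces `i'` in the
    -- merging condition at `i`. Otherwise the cyclic sum for `C` passes to `i', j', k`, where `hT`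
    -- compares it with `D`.
    by_cases hik : C i k + C k i = 0
    · have hij : C i j + C j i ≠ 0 := by
        intro hij
        have := C.add_le i k j
        have := C.add_le k i j
        have := C.add_le i j k
        have := C.add_le j i k
        have := C.add_le j k i
        omega
      have hij' : C i j' + C j' i ≠ 0 := by
        intro h0
        have := C.add_le i j' j
        have := C.add_le j j' i
        omega
      have hkj : C k j + C j k ≠ 0 := by
        intro h0
        have := C.add_le i k j
        have := C.add_le j k i
        omega
      have hkj' : C k j' + C j' k ≠ 0 := by
        intro h0
        have := C.add_le i k j'
        have := C.add_le j' k i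
        have := C.add_swap_le i j'
        omega
      have hi'k : D i' k + D k i' = 0 := by
        refine hU i' k hi' hk ?_
        have := C.add_le i' i k
        have := C.add_le k i i'
        have := C.add_swap_le i' k
        omega
      have s1 : -1 ≤ D i k + D k j' + D j' i :=
        (hi'' j' hj').trans_eq
          (D.triple_congr (D.rel.refl i) (show D.rel i' k from hi'k) (D.rel.refl j'))
      have s2 := hj'' k hk
      have := D.add_le j j' i
      have := D.add_swap_le i j
      have := hR k j'
      omega
    · have s1 := hi'' k hk
      have s2 := hi'' j' hj'
      have s3 := hj'' k hk
      have hC : C i j + C j k + C k i = C i' j' + C j' k + C k i' :=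
        C.triple_congr (show C.rel i i' from hii') (show C.rel j j' from hjj') (C.rel.refl k)
      have hT' := hT i' j' k hi' hj' hk
      have := C.le_add_swap i k
      have := C.add_swap_le i k
      have hjk : C j k + C k j ≠ 0 := by
        intro h0
        have := C.add_le i k j
        omega
      have hij : C i j + C j i ≠ 0 := by
        intro h0
        have := C.add_le j i k
        omega
      have hij' : D i j' + D j' i ≠ 0 := by
        intro h0
        have := hR _ _ h0
        have := C.add_le i j' j
        have := C.add_le j j' i
        omega
      have := D.add_le i j j'
      have := D.add_le k i i'
      have := D.add_swap_le i j'
      omega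
  have claim' : ∀ i j, K i → C j i + C i k - C j k ≤ D j i + D i k - D j k := by
    intro i j hi
    obtain ⟨j', hj', hjj', hj''⟩ := hM j
    by_contra hlt
    have q1 := C.le_add j i k
    have q2 := D.add_le j i k
    have q3 := D.le_add j i k
    have q4 := C.add_le j i k
    have c1 := C.add_swap_le j i
    have c2 := C.add_swap_le i k
    have c3 := C.add_swap_le j k
    have c4 := C.le_add_swap i k
    have c5 := C.le_add_swap j k
    have d1 := D.le_add_swap j k
    have d2 := D.add_swap_le j k
    have r1 := hR j k
    have u1 := hU i k hi hk
    by_cases hjk : D j k + D k j = 0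
    · have := C.add_le i j k
      have := C.add_le k j i
      have := D.add_le j k i
      have := D.add_le k j i
      have := D.add_le j i k
      omega
    · have hik : C i k + C k i ≠ 0 := by
        intro h0
        have := D.add_le j i k
        have := D.add_le j k i
        have := u1 h0
        omega
      have hjk' : C j k + C k j ≠ 0 := by
        intro h0
        have := C.add_le i j k
        have := C.add_le k j i
        omega
      have hjk'' : C j' k + C k j' ≠ 0 := by
        intro h0
        have := C.add_le j j' k
        have := C.add_le k j' j
        omega
      have hC : C j i + C i k + C k j = C j' i + C i k + C k j' :=
        C.triple_congr (show C.rel j j' from hjj') (C.rel.refl i) (C.rel.refl k)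
      have hT' := hT j' i k hj' hi hk
      have s1 := hj'' k hk
      have := hR j' k
      have := D.le_add_swap j' k
      have := D.add_swap_le j' k
      have := D.add_le j j' i
      omega
  -- The only choice with `V 0 = 0` for which `k` is kept.
  let V : Fin (n + 1) → ℤ := fun j => (D 0 k - C 0 k) + C j k - D j k
  have h : ∀ i j, D i j ≤ C.shift V i j := by
    intro i j
    have := claim i j
    simp only [shift_apply, V]
    omega
  have hKV : ∀ i, K i → Kept D (C.shift V) i := by
    intro i hi j
    have := claim j i
    have := claim' i j hi
    simp only [shift_apply, V]
    omega
  refine ⟨V, h, by simp [V], Hom.ext ?_⟩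
  ext X
  induction X using Quotient.inductionOn with
  | h i =>
    rw [← not_iff_not]
    -- Conversely, an `i` kept for `V` lies in the same block as the element `m` of its cluster kept
    -- by `f`, since a cluster has only one kept block.
    refine (block_notMem_homOfShift D C V h i).trans ⟨fun hi => ?_, hKV i⟩
    obtain ⟨m, hm, him, -⟩ := hM i
    have hmi : D.partition.block m = D.partition.block i := by
      refine D.block_eq_iff.2 (rel_of_kept (hKV m hm) hi ?_)
      simp only [shift_apply]
      omega
    change D.partition.block i ∉ f.removed
    rwa [← hmi]

end FloorCocycle

/-! ### Points of the covering space and their floor cocycles. -/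

namespace ToricArrangement

variable {n : ℕ}

/-- The coordinate `x_i` of a point, with the convention `x_0 = 0`. -/
noncomputable def coord (i : Fin (n + 1)) : EuclideanSpace ℝ (Fin n) →L[ℝ] ℝ :=
  Fin.cases 0 (fun k => EuclideanSpace.proj k) i

@[simp]
theorem coord_zero (x : EuclideanSpace ℝ (Fin n)) : coord 0 x = 0 := rfl

@[simp]
theorem coord_succ (k : Fin n) (x : EuclideanSpace ℝ (Fin n)) : coord k.succ x = x k := rfl

/-- The linear form `x_j - x_i`. -/
noncomputable def gap (i j : Fin (n + 1)) : EuclideanSpace ℝ (Fin n) →L[ℝ] ℝ := coord j - coord i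

theorem gap_apply (i j : Fin (n + 1)) (x : EuclideanSpace ℝ (Fin n)) :
    gap i j x = coord j x - coord i x := rfl

theorem gap_swap (i j : Fin (n + 1)) (x : EuclideanSpace ℝ (Fin n)) :
    gap j i x = - gap i j x := by
  simp [gap_apply]

/-- The floor cocycle of a point. -/
noncomputable def floorCocycle (x : EuclideanSpace ℝ (Fin n)) : FloorCocycle n where
  val i j := ⌊gap i j x⌋
  self i := by simp [gap_apply]
  add_le i j k := by
    have : gap i k x = gap i j x + gap j k x := by simp [gap_apply]
    rw [this]
    exact Int.le_floor_add _ _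
  le_add i j k := by
    have : gap i k x = gap i j x + gap j k x := by simp [gap_apply]
    rw [this]
    have := Int.le_floor_add_floor (gap i j x) (gap j k x)
    omega

theorem floorCocycle_apply (x : EuclideanSpace ℝ (Fin n)) (i j : Fin (n + 1)) :
    floorCocycle x i j = ⌊gap i j x⌋ := rfl

theorem exists_floorCocycle_eq (D : FloorCocycle n) :
    ∃ x : EuclideanSpace ℝ (Fin n), floorCocycle x = D := by
  obtain ⟨x, hx0, hx⟩ := D.exists_floor_eq
  refine ⟨WithLp.toLp 2 fun k => x k.succ, ?_⟩
  have hc : ∀ i, coord i (WithLp.toLp 2 fun k => x k.succ) = x i := by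
    intro i
    induction i using Fin.cases with
    | zero => simp [hx0]
    | succ k => simp
  obtain ⟨v, _, _, _⟩ := D
  simp only [floorCocycle, FloorCocycle.mk.injEq]
  funext i j
  rw [gap_apply, hc, hc, hx]

/-! ### The closed faces of the lifted arrangement -/

/-- The points that satisfy all the weak inequalities `c ≤ x_j - x_i`, `c ∈ ℤ`, that hold at a
given point. -/
def closedFace (x : EuclideanSpace ℝ (Fin n)) : Set (EuclideanSpace ℝ (Fin n)) :=
  {y | ∀ i j, floorCocycle x i j ≤ floorCocycle y i j}

theorem mem_closedFace {x y : EuclideanSpace ℝ (Fin n)} :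
    y ∈ closedFace x ↔ ∀ i j, (floorCocycle x i j : ℝ) ≤ gap i j y :=
  forall_congr' fun _ => forall_congr' fun _ => Int.le_floor

theorem self_mem_closedFace (x : EuclideanSpace ℝ (Fin n)) : x ∈ closedFace x := fun _ _ => le_rfl

theorem closedFace_subset {x y : EuclideanSpace ℝ (Fin n)} (h : y ∈ closedFace x) :
    closedFace y ⊆ closedFace x := fun _ hz i j => (h i j).trans (hz i j)

theorem gap_lt (x : EuclideanSpace ℝ (Fin n)) (i j : Fin (n + 1)) :
    gap i j x < floorCocycle x i j + 1 := Int.lt_floor_add_one _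

theorem gap_le_of_mem {x y : EuclideanSpace ℝ (Fin n)} (h : y ∈ closedFace x)
    (i j : Fin (n + 1)) : gap i j y ≤ floorCocycle x i j + 1 := by
  have h1 := mem_closedFace.1 h j i
  rw [gap_swap] at h1
  have h2 : (-1 : ℝ) ≤ floorCocycle x i j + floorCocycle x j i := by
    exact_mod_cast (floorCocycle x).le_add_swap i j
  linarith

theorem form_coxeterA (p : (coxeterA n).ι) (x : EuclideanSpace ℝ (Fin n)) :
    (coxeterA n).form p x = gap p.1.1 p.1.2 x := by
  have key : ∀ i : Fin (n + 1),
      ∑ k : Fin n, (if i = k.succ then (1 : ℝ) else 0) * x k = coord i x := by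
    intro i
    induction i using Fin.cases with
    | zero => simp [(Fin.succ_ne_zero _).symm]
    | succ k => simp [Fin.succ_inj]
  rw [gap_apply, ← key, ← key, ← Finset.sum_sub_distrib]
  refine Finset.sum_congr rfl fun k _ => ?_
  have hm : (coxeterA n).matrix k p =
    (if p.1.2 = k.succ then 1 else 0) - (if p.1.1 = k.succ then 1 else 0) := rfl
  rw [← sub_mul, hm]
  push_cast
  rfl

/-- `⌊u⌋` records which integers are `≤ u` and `⌊-u⌋` which are `≥ u`; both are needed to detect
whether `u` is an integer. -/
theorem sign_sub_eq_iff (u v : ℝ) :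
    (∀ c : ℝ, (c : UnitAddCircle) = 0 → SignType.sign (u - c) = SignType.sign (v - c)) ↔
      ⌊u⌋ = ⌊v⌋ ∧ ⌊-u⌋ = ⌊-v⌋ := by
  have hz : ∀ m : ℤ, ((m : ℝ) : UnitAddCircle) = 0 := fun m => by
    rw [AddCircle.coe_eq_zero_iff]
    exact ⟨m, by simp⟩
  constructor
  · intro h
    have h1 : ∀ m : ℤ, (m : ℝ) ≤ u ↔ (m : ℝ) ≤ v := fun m => by
      rw [← sub_nonneg, ← sign_nonneg_iff, h _ (hz m), sign_nonneg_iff, sub_nonneg]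
    have h2 : ∀ m : ℤ, u ≤ m ↔ v ≤ m := fun m => by
      rw [← sub_nonpos, ← sign_nonpos_iff, h _ (hz m), sign_nonpos_iff, sub_nonpos]
    constructor
    · refine le_antisymm ?_ ?_
      · exact Int.le_floor.2 ((h1 _).1 (Int.floor_le u))
      · exact Int.le_floor.2 ((h1 _).2 (Int.floor_le v))
    · have h3 := (h2 (-⌊-u⌋)).1 (by push_cast; linarith [Int.floor_le (-u)])
      have h4 := (h2 (-⌊-v⌋)).2 (by push_cast; linarith [Int.floor_le (-v)])
      push_cast at h3 h4
      exact le_antisymm (Int.le_floor.2 (by linarith)) (Int.le_floor.2 (by linarith))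
  · rintro ⟨h1, h2⟩ c hc
    obtain ⟨m, hm⟩ := (AddCircle.coe_eq_zero_iff (p := (1 : ℝ))).1 hc
    obtain rfl : (m : ℝ) = c := by simpa using hm
    have h3 : (m : ℝ) ≤ u ↔ (m : ℝ) ≤ v := by rw [← Int.le_floor, h1, Int.le_floor]
    have h4 : u ≤ m ↔ v ≤ m := by
      have : ∀ w : ℝ, w ≤ m ↔ -m ≤ ⌊-w⌋ := fun w => by
        rw [Int.le_floor]
        push_cast
        constructor <;> intro <;> linarith
      rw [this, this, h2]
    rcases lt_trichotomy u m with h | h | h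
    · have h' : v < m := not_le.1 fun hv => not_le.2 h (h3.2 hv)
      rw [sign_neg (sub_neg.2 h), sign_neg (sub_neg.2 h')]
    · have h' : v = m := le_antisymm (h4.1 h.le) (h3.1 h.ge)
      rw [h, h']
    · have h' : m < v := not_le.1 fun hv => not_le.2 h (h4.2 hv)
      rw [sign_pos (sub_pos.2 h), sign_pos (sub_pos.2 h')]

theorem sameFace_iff {x y : EuclideanSpace ℝ (Fin n)} :
    (coxeterA n).SameFace x y ↔ ∀ i j, floorCocycle x i j = floorCocycle y i j := by
  have h1 : (coxeterA n).SameFace x y ↔ ∀ p : (coxeterA n).ι,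
      floorCocycle x p.1.1 p.1.2 = floorCocycle y p.1.1 p.1.2 ∧
      floorCocycle x p.1.2 p.1.1 = floorCocycle y p.1.2 p.1.1 := by
    refine forall_congr' fun p => ?_
    simp only [form_coxeterA, floorCocycle_apply]
    rw [gap_swap p.1.1 p.1.2, gap_swap p.1.1 p.1.2, ← sign_sub_eq_iff]
    rfl
  rw [h1]
  constructor
  · intro h i j
    rcases lt_trichotomy i j with hij | rfl | hij
    · exact (h ⟨(i, j), hij⟩).1
    · rw [FloorCocycle.self, FloorCocycle.self]
    · exact (h ⟨(j, i), hij⟩).2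
  · exact fun h p => ⟨h _ _, h _ _⟩

/-- The relatively open face of a point. -/
def openFace (x : EuclideanSpace ℝ (Fin n)) : Set (EuclideanSpace ℝ (Fin n)) :=
  {y | (coxeterA n).SameFace x y}

theorem mem_openFace {x y : EuclideanSpace ℝ (Fin n)} :
    y ∈ openFace x ↔ ∀ i j, floorCocycle x i j = floorCocycle y i j := sameFace_iff

theorem self_mem_openFace (x : EuclideanSpace ℝ (Fin n)) : x ∈ openFace x :=
  mem_openFace.2 fun _ _ => rfl

theorem openFace_eq {x y : EuclideanSpace ℝ (Fin n)} (h : y ∈ openFace x) :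
    openFace y = openFace x := by
  ext z
  rw [mem_openFace] at h
  simp only [mem_openFace, h]

theorem closedFace_eq {x y : EuclideanSpace ℝ (Fin n)} (h : y ∈ openFace x) :
    closedFace y = closedFace x := by
  ext z
  rw [mem_openFace] at h
  simp only [closedFace, h]

theorem openFace_subset_closedFace (x : EuclideanSpace ℝ (Fin n)) :
    openFace x ⊆ closedFace x := fun _ hy i j => (mem_openFace.1 hy i j).le

theorem convex_closedFace (x : EuclideanSpace ℝ (Fin n)) : Convex ℝ (closedFace x) := by
  intro y hy z hz a b ha hb hab
  rw [mem_closedFace] at *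
  intro i j
  rw [map_add, map_smul, map_smul, smul_eq_mul, smul_eq_mul]
  have h1 := mul_le_mul_of_nonneg_left (hy i j) ha
  have h2 := mul_le_mul_of_nonneg_left (hz i j) hb
  have h3 : (floorCocycle x i j : ℝ) = a * floorCocycle x i j + b * floorCocycle x i j := by
    rw [← add_mul, hab, one_mul]
  linarith

theorem isClosed_closedFace (x : EuclideanSpace ℝ (Fin n)) : IsClosed (closedFace x) := by
  have : closedFace x = ⋂ i, ⋂ j, {y | (floorCocycle x i j : ℝ) ≤ gap i j y} := by
    ext y
    simp [mem_closedFace]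
  rw [this]
  exact isClosed_iInter fun i => isClosed_iInter fun j =>
    isClosed_le continuous_const (gap i j).continuous

/-- A proper convex combination of two points of a closed face lies in a relatively open face that
is at most as degenerate as those of the two points. -/
theorem mem_closedFace_combo {x y z : EuclideanSpace ℝ (Fin n)} (hy : y ∈ closedFace x)
    (hz : z ∈ closedFace x) {a b : ℝ} (ha : 0 < a) (hb : 0 ≤ b) (hab : a + b = 1) :
    y ∈ closedFace (a • y + b • z) := by
  have hw := convex_closedFace x hy hz ha.le hb hab
  intro i j
  by_contra! hlt
  have h1 := hy i j
  have h2 := gap_le_of_mem hw i j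
  have h3 := gap_le_of_mem hz i j
  have h4 := gap_lt y i j
  have h5 : (floorCocycle y i j : ℝ) + 1 ≤ floorCocycle (a • y + b • z) i j := by
    exact_mod_cast hlt
  have h6 : (floorCocycle (a • y + b • z) i j : ℝ) ≤ gap i j (a • y + b • z) := Int.floor_le _
  have h7 : (floorCocycle x i j : ℝ) ≤ floorCocycle y i j := by exact_mod_cast h1
  rw [map_add, map_smul, map_smul, smul_eq_mul, smul_eq_mul] at h6
  have h8 := mul_lt_mul_of_pos_left h4 ha
  have h9 := mul_le_mul_of_nonneg_left (h3.trans (add_le_add_left h7 1)) hb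
  have h10 : a * ((floorCocycle y i j : ℝ) + 1) + b * (floorCocycle y i j + 1) =
      floorCocycle y i j + 1 := by
    rw [← add_mul, hab, one_mul]
  linarith

theorem combo_mem_openFace {x y : EuclideanSpace ℝ (Fin n)} (hy : y ∈ closedFace x)
    {a b : ℝ} (ha : 0 < a) (hb : 0 ≤ b) (hab : a + b = 1) : a • x + b • y ∈ openFace x :=
  mem_openFace.2 fun i j => le_antisymm
    (convex_closedFace x (self_mem_closedFace x) hy ha.le hb hab i j)
    (mem_closedFace_combo (self_mem_closedFace x) hy ha hb hab i j)

/-- Every `y` in the closed face is the limit, as `t → 0+`, of the points `t • x + (1 - t) • y`,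
which lie in the open face. -/
theorem closure_openFace (x : EuclideanSpace ℝ (Fin n)) : closure (openFace x) = closedFace x := by
  refine Set.Subset.antisymm
    (closure_minimal (openFace_subset_closedFace x) (isClosed_closedFace x)) fun y hy => ?_
  have hc : Continuous fun t : ℝ => t • x + (1 - t) • y := by fun_prop
  have ht : Filter.Tendsto (fun t : ℝ => t • x + (1 - t) • y) (nhdsWithin 0 (Set.Ioi 0))
      (nhds y) := by
    have := (hc.tendsto 0).mono_left (nhdsWithin_le_nhds (s := Set.Ioi 0))
    simpa using this
  refine mem_closure_of_tendsto ht ?_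
  filter_upwards [Ioo_mem_nhdsGT (zero_lt_one' ℝ)] with t ht
  exact combo_mem_openFace hy ht.1 (by linarith [ht.2]) (by ring)

/-- Every segment in the closed face of a point that ends in this point can be extended. -/
theorem exists_extend_mem_closedFace {x y : EuclideanSpace ℝ (Fin n)} (hy : y ∈ closedFace x) :
    ∃ ε : ℝ, 0 < ε ∧ x + ε • (x - y) ∈ closedFace x := by
  have key : ∀ i j, ∀ᶠ ε : ℝ in nhdsWithin 0 (Set.Ioi 0),
      (floorCocycle x i j : ℝ) ≤ gap i j (x + ε • (x - y)) := by
    intro i j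
    have hx : (floorCocycle x i j : ℝ) ≤ gap i j x := Int.floor_le _
    rcases hx.eq_or_lt with h | h
    · have h1 := mem_closedFace.1 hy j i
      have h2 : floorCocycle x j i = - floorCocycle x i j := by
        rw [floorCocycle_apply x j i, gap_swap, ← h, ← Int.cast_neg, Int.floor_intCast]
      rw [h2, gap_swap, Int.cast_neg, neg_le_neg_iff] at h1
      filter_upwards [self_mem_nhdsWithin] with ε hε
      rw [map_add, map_smul, map_sub, smul_eq_mul, ← h]
      have : 0 ≤ ε * (floorCocycle x i j - gap i j y) :=
        mul_nonneg (le_of_lt hε) (sub_nonneg.2 h1)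
      linarith
    · have hc : Continuous fun ε : ℝ => gap i j (x + ε • (x - y)) := by fun_prop
      have := hc.tendsto 0
      simp only [zero_smul, add_zero] at this
      exact ((this.eventually_const_lt h).filter_mono nhdsWithin_le_nhds).mono fun _ => le_of_lt
  have h1 : ∀ᶠ ε : ℝ in nhdsWithin 0 (Set.Ioi 0), ∀ i j,
      (floorCocycle x i j : ℝ) ≤ gap i j (x + ε • (x - y)) :=
    Filter.eventually_all.2 fun i => Filter.eventually_all.2 fun j => key i j
  obtain ⟨ε, hε, hpos⟩ := (h1.and self_mem_nhdsWithin).exists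
  exact ⟨ε, hpos, mem_closedFace.2 hε⟩

end ToricArrangement

/-! ### Closed faces as polytopes, their relative interiors and their faces. -/

namespace ToricArrangement

variable {n : ℕ}

theorem isCompact_closedFace (x : EuclideanSpace ℝ (Fin n)) : IsCompact (closedFace x) := by
  have h1 : IsCompact (WithLp.toLp 2 '' Set.pi Set.univ fun k : Fin n =>
      Set.Icc (floorCocycle x 0 k.succ : ℝ) (floorCocycle x 0 k.succ + 1)) :=
    (isCompact_univ_pi fun _ => isCompact_Icc).image (PiLp.continuous_toLp 2 _)
  refine h1.of_isClosed_subset (isClosed_closedFace x) fun y hy => ?_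
  refine ⟨fun k => y k, fun k _ => ?_, rfl⟩
  have h2 := mem_closedFace.1 hy 0 k.succ
  have h3 := gap_le_of_mem hy 0 k.succ
  simp only [gap_apply, coord_zero, coord_succ, sub_zero] at h2 h3
  exact ⟨h2, h3⟩

theorem floorCocycle_le_add_one {x y : EuclideanSpace ℝ (Fin n)} (h : y ∈ closedFace x)
    (i j : Fin (n + 1)) : floorCocycle y i j ≤ floorCocycle x i j + 1 :=
  FloorCocycle.le_add_one h i j

/-- Only finitely many cocycles occur on the closed face, and an extreme point is determined by its
cocycle: if `z` has the cocycle of `y`, the segment from `z` to `y` extends beyond `y`, so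
extremality forces `z = y`. Krein–Milman then yields a polytope. -/
theorem finite_extremePoints_closedFace (x : EuclideanSpace ℝ (Fin n)) :
    ((closedFace x).extremePoints ℝ).Finite := by
  refine Set.Finite.of_injOn (f := fun y i j => floorCocycle y i j)
    (t := {D | ∀ i, D i ∈ {d : Fin (n + 1) → ℤ |
      ∀ j, d j ∈ Set.Icc (floorCocycle x i j) (floorCocycle x i j + 1)}}) ?_ ?_
    (Set.Finite.pi' fun i => Set.Finite.pi' fun j => Set.finite_Icc _ _)
  · exact fun y hy i j => ⟨hy.1 i j, floorCocycle_le_add_one hy.1 i j⟩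
  · intro y hy z hz hyz
    have hzy : z ∈ closedFace y := fun i j => (congrFun (congrFun hyz i) j).le
    obtain ⟨ε, hε, hw⟩ := exists_extend_mem_closedFace hzy
    refine ((mem_extremePoints.1 hy).2 z hz.1 _ (closedFace_subset hy.1 hw) ?_).1.symm
    refine ⟨ε / (1 + ε), 1 / (1 + ε), by positivity, by positivity, by field_simp; ring, ?_⟩
    ext k
    simp
    field_simp
    ring

theorem isPolytope_closedFace (x : EuclideanSpace ℝ (Fin n)) : IsPolytope (closedFace x) := by
  have hfin := finite_extremePoints_closedFace x
  refine ⟨_, hfin, (isCompact_closedFace x).extremePoints_nonempty ⟨x, self_mem_closedFace x⟩, ?_⟩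
  rw [← (hfin.isClosed_convexHull ℝ).closure_eq,
    closure_convexHull_extremePoints (isCompact_closedFace x) (convex_closedFace x)]

/-- From an interior point `y` the segment from `x` can be prolonged inside the face, making `y` a
proper combination involving `x`. Conversely, at a point of the open face the tight inequalities are
equalities on the affine span, and the strict ones persist nearby. -/
theorem intrinsicInterior_closedFace (x : EuclideanSpace ℝ (Fin n)) :
    intrinsicInterior ℝ (closedFace x) = openFace x := by
  ext y
  rw [mem_intrinsicInterior]
  constructor
  · rintro ⟨⟨y, hys⟩, hy, rfl⟩
    have hyx : y ∈ closedFace x := Set.mem_preimage.1 (interior_subset hy)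
    have hxs : x ∈ affineSpan ℝ (closedFace x) := subset_affineSpan ℝ _ (self_mem_closedFace x)
    let f : ℝ → affineSpan ℝ (closedFace x) := fun t =>
      ⟨AffineMap.lineMap x y t, AffineMap.lineMap_mem t hxs hys⟩
    have hf : Continuous f := by
      refine Continuous.subtype_mk ?_ _
      exact AffineMap.lineMap_continuous
    have hf1 : f 1 = ⟨y, hys⟩ := Subtype.ext (AffineMap.lineMap_apply_one x y)
    have hev : ∀ᶠ t in nhdsWithin (1 : ℝ) (Set.Ioi 1), f t ∈
        interior ((↑) ⁻¹' closedFace x : Set (affineSpan ℝ (closedFace x))) := by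
      refine (hf.tendsto 1).eventually ?_ |>.filter_mono nhdsWithin_le_nhds
      rw [hf1]
      exact isOpen_interior.mem_nhds hy
    obtain ⟨t, ht, ht1⟩ := (hev.and self_mem_nhdsWithin).exists
    have ht1 : 1 < t := ht1
    have hft := interior_subset ht
    have hz : AffineMap.lineMap x y t ∈ closedFace x := hft
    have ht0 : 0 < t := by linarith
    have hy' : y = (1 - 1 / t) • x + (1 / t) • AffineMap.lineMap x y t := by
      rw [AffineMap.lineMap_apply]
      ext k
      simp
      field_simp
      ring
    change y ∈ openFace x
    rw [hy']
    refine combo_mem_openFace hz ?_ (by positivity) (by ring)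
    rw [sub_pos, div_lt_one ht0]
    exact ht1
  · intro hy
    have hyc := openFace_subset_closedFace x hy
    refine ⟨⟨y, subset_affineSpan ℝ _ hyc⟩, ?_, rfl⟩
    rw [mem_interior_iff_mem_nhds]
    have key : ∀ i j, ∀ᶠ z : affineSpan ℝ (closedFace x) in
        nhds ⟨y, subset_affineSpan ℝ _ hyc⟩, (floorCocycle x i j : ℝ) ≤ gap i j z := by
      intro i j
      have hyij : (floorCocycle x i j : ℝ) ≤ gap i j y := mem_closedFace.1 hyc i j
      rcases hyij.eq_or_lt with h | h
      · refine Filter.Eventually.of_forall fun z => ?_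
        have hji : floorCocycle x j i = - floorCocycle x i j := by
          rw [mem_openFace.1 hy j i, floorCocycle_apply y j i, gap_swap, ← h, ← Int.cast_neg,
            Int.floor_intCast]
        let s : AffineSubspace ℝ (EuclideanSpace ℝ (Fin n)) :=
          (AffineSubspace.mk' (floorCocycle x i j : ℝ) ⊥).comap
            (gap i j).toLinearMap.toAffineMap
        have hs : affineSpan ℝ (closedFace x) ≤ s := by
          refine affineSpan_le.2 fun w hw => ?_
          have h1 := mem_closedFace.1 hw i j
          have h2 := mem_closedFace.1 hw j i
          rw [hji, gap_swap, Int.cast_neg, neg_le_neg_iff] at h2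
          simp [s, AffineSubspace.mem_mk', le_antisymm h2 h1]
        have hz := hs z.2
        simp [s, AffineSubspace.mem_mk', sub_eq_zero] at hz
        exact hz.ge
      · have hc : Continuous fun z : affineSpan ℝ (closedFace x) => gap i j z := by fun_prop
        exact ((hc.tendsto _).eventually_const_lt h).mono fun _ => le_of_lt
    have h1 : ∀ᶠ z : affineSpan ℝ (closedFace x) in
        nhds ⟨y, subset_affineSpan ℝ _ hyc⟩, ∀ i j, (floorCocycle x i j : ℝ) ≤ gap i j z :=
      Filter.eventually_all.2 fun i => Filter.eventually_all.2 fun j => key i j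
    exact h1.mono fun z hz => mem_closedFace.2 hz

/-- Each gap whose floor jumps at `y` is bounded above on the closed face of `x` by the value
reached there. The negated sum of these gaps is the supporting form: equality in the sum forces
equality in each term. -/
theorem isPolytopeFace_closedFace {x y : EuclideanSpace ℝ (Fin n)} (h : y ∈ closedFace x) :
    IsPolytopeFace (closedFace x) (closedFace y) := by
  refine ⟨⟨y, self_mem_closedFace y⟩, ?_⟩
  let s : Finset (Fin (n + 1) × Fin (n + 1)) :=
    {p | floorCocycle x p.1 p.2 < floorCocycle y p.1 p.2}
  have hle : ∀ z ∈ closedFace x, ∀ p ∈ s,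
      -((floorCocycle x p.1 p.2 : ℝ) + 1) ≤ -gap p.1 p.2 z := fun z hz p _ =>
    neg_le_neg (gap_le_of_mem hz p.1 p.2)
  refine ⟨∑ p ∈ s, -(gap p.1 p.2).toLinearMap, ∑ p ∈ s, -((floorCocycle x p.1 p.2 : ℝ) + 1), ?_, ?_⟩
  · intro z hz
    rw [LinearMap.sum_apply]
    exact Finset.sum_le_sum (hle z hz)
  · ext z
    rw [Set.mem_ofPred_eq, LinearMap.sum_apply]
    have hs : ∀ p ∈ s, floorCocycle y p.1 p.2 = floorCocycle x p.1 p.2 + 1 := by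
      intro p hp
      have h1 := floorCocycle_le_add_one h p.1 p.2
      have h2 : floorCocycle x p.1 p.2 < floorCocycle y p.1 p.2 := by simpa [s] using hp
      omega
    constructor
    · intro hz
      have hzx := closedFace_subset h hz
      refine ⟨hzx, Finset.sum_congr rfl fun p hp => le_antisymm ?_ (hle z hzx p hp)⟩
      have h1 := mem_closedFace.1 hz p.1 p.2
      rw [hs p hp] at h1
      push_cast at h1
      exact neg_le_neg h1
    · rintro ⟨hzx, hsum⟩
      have heq := (Finset.sum_eq_sum_iff_of_le (hle z hzx)).1 hsum.symm
      refine mem_closedFace.2 fun i j => ?_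
      by_cases hp : (i, j) ∈ s
      · rw [hs _ hp]
        have := heq _ hp
        push_cast
        linarith
      · have h1 : floorCocycle y i j ≤ floorCocycle x i j := by simpa [s] using hp
        exact le_trans (by exact_mod_cast h1) (mem_closedFace.1 hzx i j)

/-- Take `y` in `F` least degenerate, measured by the total excess `f` of its cocycle. The midpoint
with any `z` in `F` is no more degenerate, so by minimality it has the cocycle of `y`, and `z` lies
in its closed face. For the converse, a segment from `z` extended past `y` would violate `c ≤ l` if
`l z > c`. -/
theorem exists_eq_closedFace {x : EuclideanSpace ℝ (Fin n)} {F : Set (EuclideanSpace ℝ (Fin n))}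
    (hF : IsPolytopeFace (closedFace x) F) : ∃ y ∈ closedFace x, F = closedFace y := by
  obtain ⟨hne, l, c, hl, rfl⟩ := hF
  let f : EuclideanSpace ℝ (Fin n) → ℕ := fun y =>
    ∑ i, ∑ j, (floorCocycle y i j - floorCocycle x i j).toNat
  obtain ⟨y, ⟨hyx, hly⟩, hmin⟩ : ∃ y ∈ {z ∈ closedFace x | l z = c},
      ∀ z ∈ {z ∈ closedFace x | l z = c}, f y ≤ f z := by
    obtain ⟨y, hy⟩ := hne
    exact ⟨_, Function.argminOn_mem f _ ⟨y, hy⟩, fun z hz => Function.argminOn_le f _ hz⟩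
  refine ⟨y, hyx, Set.Subset.antisymm ?_ ?_⟩
  · rintro z ⟨hzx, hlz⟩
    have h1 := mem_closedFace_combo hyx hzx (a := 1 / 2) (b := 1 / 2) (by norm_num) (by norm_num)
      (by norm_num)
    have h2 := mem_closedFace_combo hzx hyx (a := 1 / 2) (b := 1 / 2) (by norm_num) (by norm_num)
      (by norm_num)
    rw [add_comm] at h2
    set w := (1 / 2 : ℝ) • y + (1 / 2 : ℝ) • z with hw
    have hwx : w ∈ closedFace x :=
      convex_closedFace x hyx hzx (by norm_num) (by norm_num) (by norm_num)
    have hlw : l w = c := by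
      rw [hw, map_add, map_smul, map_smul, hly, hlz, smul_eq_mul]
      ring
    have h3 := hmin w ⟨hwx, hlw⟩
    have h4 : ∀ i j, (floorCocycle w i j - floorCocycle x i j).toNat ≤
        (floorCocycle y i j - floorCocycle x i j).toNat := fun i j => by
      have := h1 i j
      omega
    have h5 : f y = f w :=
      le_antisymm h3 (Finset.sum_le_sum fun i _ => Finset.sum_le_sum fun j _ => h4 i j)
    intro i j
    refine le_trans ?_ (h2 i j)
    have h6 := (Finset.sum_eq_sum_iff_of_le
      (fun i _ => Finset.sum_le_sum fun j _ => h4 i j)).1 h5.symm i (Finset.mem_univ i)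
    have h7 := (Finset.sum_eq_sum_iff_of_le (fun j _ => h4 i j)).1 h6 j (Finset.mem_univ j)
    have := hwx i j
    have := hyx i j
    omega
  · intro z hz
    have hzx := closedFace_subset hyx hz
    refine ⟨hzx, le_antisymm ?_ (hl z hzx)⟩
    obtain ⟨ε, hε, hw⟩ := exists_extend_mem_closedFace hz
    have h1 := hl _ (closedFace_subset hyx hw)
    rw [map_add, map_smul, map_sub, hly, smul_eq_mul] at h1
    have h2 : 0 ≤ ε * (c - l z) := by linarith
    linarith [nonneg_of_mul_nonneg_right h2 hε]

end ToricArrangement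

/-- Gives finiteness of the set of cells, hence the weak topology. -/
theorem CyclicPartition.finite (n : ℕ) : Finite (CyclicPartition n) := by
  refine Finite.of_injective (fun x : CyclicPartition n =>
    ((fun i j => x.rel i j, fun i j k => btw (x.block i) (x.block j) (x.block k)) :
      (Fin (n + 1) → Fin (n + 1) → Prop) × (Fin (n + 1) → Fin (n + 1) → Fin (n + 1) → Prop))) ?_
  intro x y h
  rw [Prod.mk.injEq] at h
  exact CyclicPartition.ext_of_btw (fun i j => iff_of_eq (congrFun (congrFun h.1 i) j))
    fun i j k => iff_of_eq (congrFun (congrFun (congrFun h.2 i) j) k)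

theorem FloorCocycle.partition_shift {n : ℕ} (D : FloorCocycle n) (V : Fin (n + 1) → ℤ) :
    (D.shift V).partition = D.partition := by
  refine CyclicPartition.ext_of_btw (fun i j => ?_) fun i j k => ?_
  · change D.shift V i j + D.shift V j i = 0 ↔ D i j + D j i = 0
    simp only [shift_apply]
    constructor <;> intro <;> omega
  · rw [partition_btw, partition_btw]
    simp only [shift_apply]
    constructor <;> intro <;> omega

@[ext]
theorem FloorCocycle.ext {n : ℕ} {D C : FloorCocycle n} (h : ∀ i j, D i j = C i j) : D = C := by
  obtain ⟨v, _, _, _⟩ := D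
  obtain ⟨w, _, _, _⟩ := C
  obtain rfl : v = w := funext fun i => funext fun j => h i j
  rfl

namespace ToricArrangement

variable {n : ℕ}

/-! ### Deck transformations -/

/-- The extension of an integral vector by `v_0 = 0`. -/
def consZero (v : Fin n → ℤ) : Fin (n + 1) → ℤ := Fin.cons 0 v

theorem coord_deck (v : Fin n → ℤ) (x : EuclideanSpace ℝ (Fin n)) (i : Fin (n + 1)) :
    coord i (deck v x) = coord i x + consZero v i := by
  induction i using Fin.cases with
  | zero => simp [consZero]
  | succ k => simp [consZero, deck]

theorem floorCocycle_deck (v : Fin n → ℤ) (x : EuclideanSpace ℝ (Fin n)) :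
    floorCocycle (deck v x) = (floorCocycle x).shift (consZero v) := by
  ext i j
  rw [FloorCocycle.shift_apply, floorCocycle_apply, floorCocycle_apply, gap_apply, coord_deck,
    coord_deck, ← Int.floor_add_intCast, ← Int.floor_sub_intCast, gap_apply]
  congr 1
  ring

theorem partition_deck (v : Fin n → ℤ) (x : EuclideanSpace ℝ (Fin n)) :
    (floorCocycle (deck v x)).partition = (floorCocycle x).partition := by
  rw [floorCocycle_deck, FloorCocycle.partition_shift]

theorem deck_mem_closedFace (v : Fin n → ℤ) {x y : EuclideanSpace ℝ (Fin n)} :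
    deck v y ∈ closedFace (deck v x) ↔ y ∈ closedFace x := by
  refine forall_congr' fun i => forall_congr' fun j => ?_
  rw [floorCocycle_deck, floorCocycle_deck, FloorCocycle.shift_apply, FloorCocycle.shift_apply]
  constructor <;> intro <;> omega

theorem deck_mem_openFace (v : Fin n → ℤ) {x y : EuclideanSpace ℝ (Fin n)} :
    deck v y ∈ openFace (deck v x) ↔ y ∈ openFace x := by
  rw [mem_openFace, mem_openFace]
  refine forall_congr' fun i => forall_congr' fun j => ?_
  rw [floorCocycle_deck, floorCocycle_deck, FloorCocycle.shift_apply, FloorCocycle.shift_apply]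
  constructor <;> intro <;> omega

theorem deck_neg_deck (v : Fin n → ℤ) (x : EuclideanSpace ℝ (Fin n)) :
    deck v (deck (-v) x) = x := by
  ext k
  simp [deck]

theorem image_deck_closedFace (v : Fin n → ℤ) (x : EuclideanSpace ℝ (Fin n)) :
    deck v '' closedFace x = closedFace (deck v x) := by
  ext y
  constructor
  · rintro ⟨z, hz, rfl⟩
    exact (deck_mem_closedFace v).2 hz
  · intro hy
    rw [← deck_neg_deck v y, deck_mem_closedFace] at hy
    exact ⟨_, hy, deck_neg_deck v y⟩

theorem image_deck_openFace (v : Fin n → ℤ) (x : EuclideanSpace ℝ (Fin n)) :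
    deck v '' openFace x = openFace (deck v x) := by
  ext y
  constructor
  · rintro ⟨z, hz, rfl⟩
    exact (deck_mem_openFace v).2 hz
  · intro hy
    rw [← deck_neg_deck v y, deck_mem_openFace] at hy
    exact ⟨_, hy, deck_neg_deck v y⟩

theorem coe_eq_coe_iff (a b : ℝ) : (a : UnitAddCircle) = b ↔ ∃ m : ℤ, b = a + m := by
  rw [eq_comm, ← sub_eq_zero, ← AddCircle.coe_sub, AddCircle.coe_eq_zero_iff]
  refine exists_congr fun m => ?_
  rw [zsmul_eq_mul, mul_one, eq_sub_iff_add_eq, eq_comm, add_comm]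

theorem cover_deck (v : Fin n → ℤ) (x : EuclideanSpace ℝ (Fin n)) :
    cover n (deck v x) = cover n x := by
  funext k
  exact ((coe_eq_coe_iff _ _).2 ⟨v k, by simp [deck]⟩).symm

theorem exists_deck_of_cover_eq {x y : EuclideanSpace ℝ (Fin n)} (h : cover n x = cover n y) :
    ∃ v, y = deck v x := by
  have h1 : ∀ k, ∃ m : ℤ, y k = x k + m := fun k => (coe_eq_coe_iff _ _).1 (congrFun h k)
  choose v hv using h1
  refine ⟨v, ?_⟩
  ext k
  simp [deck, hv]

theorem continuous_cover : Continuous (cover n) :=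
  continuous_pi fun k =>
    (AddCircle.continuous_mk' 1).comp (EuclideanSpace.proj (𝕜 := ℝ) k).continuous

theorem cover_surjective : Function.Surjective (cover n) := by
  intro p
  choose x hx using fun k => QuotientAddGroup.mk_surjective (p k)
  exact ⟨WithLp.toLp 2 x, funext hx⟩

theorem isOpenMap_cover : IsOpenMap (cover n) := by
  have h1 : IsOpenMap (Pi.map fun (_ : Fin n) (t : ℝ) => (t : UnitAddCircle)) :=
    IsOpenMap.piMap (fun _ => QuotientAddGroup.isOpenMap_coe) (by simp)
  exact h1.comp (PiLp.homeomorph 2 fun _ : Fin n => ℝ).isOpenMap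

/-! ### The cells of the quotient complex -/

/-- A point of the relatively open face that represents a cell. -/
noncomputable def point (α : (coxeterA n).complex.Cell) : EuclideanSpace ℝ (Fin n) :=
  Classical.choose (Quotient.out α).2

theorem out_eq (α : (coxeterA n).complex.Cell) : (Quotient.out α).1 = openFace (point α) :=
  Classical.choose_spec (Quotient.out α).2

theorem polytope_eq (α : (coxeterA n).complex.Cell) :
    (coxeterA n).complex.polytope α = closedFace (point α) := by
  change closure (Quotient.out α).1 = _
  rw [out_eq, closure_openFace]

theorem mem_polytope {α : (coxeterA n).complex.Cell} {y : EuclideanSpace ℝ (Fin n)} :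
    y ∈ (coxeterA n).complex.polytope α ↔ y ∈ closedFace (point α) :=
  Set.ext_iff.1 (polytope_eq α) y

theorem mem_intrinsicInterior_polytope {α : (coxeterA n).complex.Cell}
    {y : EuclideanSpace ℝ (Fin n)} :
    y ∈ intrinsicInterior ℝ ((coxeterA n).complex.polytope α) ↔ y ∈ openFace (point α) := by
  rw [polytope_eq, intrinsicInterior_closedFace]

/-- The cell of a point. -/
def cellOf (x : EuclideanSpace ℝ (Fin n)) : (coxeterA n).complex.Cell :=
  Quotient.mk _ ⟨openFace x, x, rfl⟩

theorem exists_deck_point_cellOf (x : EuclideanSpace ℝ (Fin n)) :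
    ∃ v, deck v (point (cellOf x)) ∈ openFace x := by
  obtain ⟨v, hv⟩ := Quotient.mk_out (s := (coxeterA n).orbitSetoid) ⟨openFace x, x, rfl⟩
  refine ⟨v, ?_⟩
  have hv : openFace x = deck v '' (Quotient.out (cellOf x)).1 := hv
  rw [hv, out_eq]
  exact Set.mem_image_of_mem _ (self_mem_openFace _)

theorem eq_of_deck_point_mem {α β : (coxeterA n).complex.Cell} {v : Fin n → ℤ}
    (h : deck v (point α) ∈ openFace (point β)) : α = β := by
  rw [← Quotient.out_eq α, ← Quotient.out_eq β]
  refine Quotient.sound ⟨v, ?_⟩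
  rw [out_eq, out_eq, image_deck_openFace, openFace_eq h]

theorem mem_openCell {α : (coxeterA n).complex.Cell} {p : Fin n → UnitAddCircle} :
    p ∈ (coxeterA n).complex.openCell α ↔ ∃ y ∈ openFace (point α), cover n y = p := by
  constructor
  · rintro ⟨⟨y, hy⟩, hyi, rfl⟩
    exact ⟨y, mem_intrinsicInterior_polytope.1 hyi, rfl⟩
  · rintro ⟨y, hy, rfl⟩
    exact ⟨⟨y, mem_polytope.2 (openFace_subset_closedFace _ hy)⟩,
      mem_intrinsicInterior_polytope.2 hy, rfl⟩

/-- The morphism of the face category given by a deck transformation that maps the polytope of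
one cell into the polytope of another one as a face. -/
def faceHomOfDeck {α β : (coxeterA n).complex.Cell} (v : Fin n → ℤ)
    (h : deck v (point β) ∈ closedFace (point α)) :
    CellFamily.FaceHom (coxeterA n).complex β α where
  toFun y := ⟨deck v y, mem_polytope.2
    (closedFace_subset h ((deck_mem_closedFace v).2 (mem_polytope.1 y.2)))⟩
  isFaceMap :=
    { isEmbedding := by
        refine Topology.IsEmbedding.codRestrict ?_ _ _
        exact (Homeomorph.addRight (WithLp.toLp 2 fun k => (v k : ℝ))).isEmbedding.comp
          Topology.IsEmbedding.subtypeVal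
      image_face := by
        intro F hF
        rw [polytope_eq] at hF
        obtain ⟨y, hy, rfl⟩ := exists_eq_closedFace hF
        have : {z | ∃ x : (coxeterA n).complex.polytope β, (x : EuclideanSpace ℝ (Fin n)) ∈
            closedFace y ∧ deck v x = z} = closedFace (deck v y) := by
          rw [← image_deck_closedFace]
          ext z
          constructor
          · rintro ⟨x, hx, rfl⟩
            exact ⟨x, hx, rfl⟩
          · rintro ⟨x, hx, rfl⟩
            exact ⟨⟨x, mem_polytope.2 (closedFace_subset hy hx)⟩, hx, rfl⟩
        rw [this, polytope_eq]
        exact isPolytopeFace_closedFace (closedFace_subset h ((deck_mem_closedFace v).2 hy)) }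
  char_comp y := cover_deck v y

/-- On an open face each coordinate is either a constant integer or confined between consecutive
integers. The face thus lies in an open unit cube, where the covering map is injective. -/
theorem exists_Ioo_of_openFace (p : EuclideanSpace ℝ (Fin n)) (k : Fin n) :
    ∃ a : ℝ, ∀ y ∈ openFace p, y k ∈ Set.Ioo a (a + 1) := by
  have hfloor : ∀ y ∈ openFace p, ⌊p k⌋ = ⌊y k⌋ ∧ ⌊-p k⌋ = ⌊-y k⌋ := by
    intro y hy
    rw [mem_openFace] at hy
    have h1 := hy 0 k.succ
    have h2 := hy k.succ 0
    simpa [floorCocycle_apply, gap_apply] using And.intro h1 h2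
  by_cases hp : (⌊p k⌋ : ℝ) = p k
  · refine ⟨⌊p k⌋ - 1 / 2, fun y hy => ?_⟩
    obtain ⟨h1, h2⟩ := hfloor y hy
    have h3 := Int.floor_le (y k)
    have h4 := Int.floor_le (-y k)
    rw [← h2, ← hp, ← Int.cast_neg, Int.floor_intCast] at h4
    rw [← h1] at h3
    push_cast at h4
    constructor <;> linarith
  · refine ⟨⌊p k⌋, fun y hy => ⟨lt_of_le_of_ne ?_ ?_, ?_⟩⟩
    · rw [(hfloor y hy).1]
      exact Int.floor_le _
    · intro h
      obtain ⟨-, h2⟩ := hfloor y hy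
      rw [← h, ← Int.cast_neg, Int.floor_intCast] at h2
      refine hp (le_antisymm (Int.floor_le _) ?_)
      have := Int.floor_le (-p k)
      rw [h2] at this
      push_cast at this
      linarith
    · rw [(hfloor y hy).1]
      exact Int.lt_floor_add_one _

theorem isEmbedding_cover_openFace (p : EuclideanSpace ℝ (Fin n)) :
    Topology.IsEmbedding fun y : openFace p => cover n y := by
  choose a ha using exists_Ioo_of_openFace p
  let U : Set (EuclideanSpace ℝ (Fin n)) := {y | ∀ k, y k ∈ Set.Ioo (a k) (a k + 1)}
  have hU : IsOpen U := by
    have : U = ⋂ k, (fun y : EuclideanSpace ℝ (Fin n) => y k) ⁻¹' Set.Ioo (a k) (a k + 1) := by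
      ext y
      simp [U]
    rw [this]
    exact isOpen_iInter_of_finite fun k =>
      isOpen_Ioo.preimage (EuclideanSpace.proj (𝕜 := ℝ) k).continuous
  have hopen : Topology.IsOpenEmbedding fun y : U => cover n y := by
    refine Topology.IsOpenEmbedding.of_continuous_injective_isOpenMap
      (continuous_cover.comp continuous_subtype_val) ?_ (isOpenMap_cover.domRestrict hU)
    rintro ⟨y, hy⟩ ⟨z, hz⟩ hyz
    refine Subtype.ext ?_
    ext k
    exact (AddCircle.coe_eq_coe_iff_of_mem_Ico (p := (1 : ℝ)) (Set.Ioo_subset_Ico_self (hy k))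
      (Set.Ioo_subset_Ico_self (hz k))).1 (congrFun hyz k)
  exact hopen.isEmbedding.comp (Topology.IsEmbedding.inclusion (t := U) fun y hy k => ha k y hy)

/-- Equal cyclic partitions give cocycles differing by a coboundary, hence representing points whose
open faces are translates of each other. -/
theorem partition_point_injective :
    Function.Injective fun α : (coxeterA n).complex.Cell => (floorCocycle (point α)).partition := by
  intro α β h
  obtain ⟨V, hV0, hV⟩ := FloorCocycle.exists_shift_of_partition_eq _ _ h
  refine eq_of_deck_point_mem (v := fun k => V k.succ) ?_
  rw [mem_openFace]
  intro i j
  have : consZero (fun k => V k.succ) = V := by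
    funext i
    induction i using Fin.cases with
    | zero => simp [consZero, hV0]
    | succ k => simp [consZero]
  rw [floorCocycle_deck, this, hV, FloorCocycle.shift_apply]

theorem partition_point_surjective :
    Function.Surjective fun α : (coxeterA n).complex.Cell =>
      (floorCocycle (point α)).partition := by
  intro y
  obtain ⟨x, hx⟩ := exists_floorCocycle_eq (FloorCocycle.ofPartition y)
  obtain ⟨v, hv⟩ := exists_deck_point_cellOf x
  refine ⟨cellOf x, ?_⟩
  have h : floorCocycle (deck v (point (cellOf x))) = floorCocycle x :=
    FloorCocycle.ext fun i j => (mem_openFace.1 hv i j).symm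
  change (floorCocycle (point (cellOf x))).partition = y
  rw [← partition_deck v, h, hx, FloorCocycle.partition_ofPartition]

/-! ### The axioms of a polyhedral CW complex. -/

theorem isPolyhedralCW_coxeterA (n : ℕ) : (coxeterA n).complex.IsPolyhedralCW where
  t2 := inferInstance
  isPolytope α := by
    rw [polytope_eq]
    exact isPolytope_closedFace _
  continuous_char α := continuous_cover.comp continuous_subtype_val
  homeo_interior α := by
    have h : ∀ x : {x : (coxeterA n).complex.polytope α // (x : EuclideanSpace ℝ (Fin n)) ∈
        intrinsicInterior ℝ ((coxeterA n).complex.polytope α)},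
        (x.1 : EuclideanSpace ℝ (Fin n)) ∈ openFace (point α) :=
      fun x => mem_intrinsicInterior_polytope.1 x.2
    exact (isEmbedding_cover_openFace (point α)).comp
      ((Topology.IsEmbedding.subtypeVal.comp Topology.IsEmbedding.subtypeVal).codRestrict _ h)
  disjointUnion p := by
    obtain ⟨x, rfl⟩ := cover_surjective p
    obtain ⟨v, hv⟩ := exists_deck_point_cellOf x
    refine ⟨cellOf x, mem_openCell.2 ⟨deck (-v) x, ?_, cover_deck _ _⟩, ?_⟩
    · rw [← deck_mem_openFace v, deck_neg_deck, openFace_eq hv]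
      exact self_mem_openFace x
    · intro β hβ
      obtain ⟨y, hy, hyx⟩ := mem_openCell.1 hβ
      obtain ⟨w, rfl⟩ := exists_deck_of_cover_eq hyx
      refine partition_point_injective ?_
      have h1 : floorCocycle (point β) = floorCocycle y :=
        FloorCocycle.ext (mem_openFace.1 hy)
      have h2 : floorCocycle (deck w y) = floorCocycle (deck v (point (cellOf (deck w y)))) :=
        FloorCocycle.ext (mem_openFace.1 hv)
      change (floorCocycle (point β)).partition =
        (floorCocycle (point (cellOf (deck w y)))).partition
      rw [h1, ← partition_deck w, h2, partition_deck]
  isClosed_iff S := by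
    have hrange : ∀ α, Set.range ((coxeterA n).complex.char α) =
        cover n '' closedFace (point α) := by
      intro α
      rw [← polytope_eq]
      ext p
      constructor
      · rintro ⟨y, rfl⟩
        exact ⟨y, y.2, rfl⟩
      · rintro ⟨y, hy, rfl⟩
        exact ⟨⟨y, hy⟩, rfl⟩
    -- With finitely many compact closed cells covering the torus, the weak topology is automatic.
    have hfin : Finite (coxeterA n).complex.Cell :=
      have := CyclicPartition.finite n
      Finite.of_injective _ partition_point_injective
    constructor
    · intro hS α
      rw [hrange]
      exact hS.inter ((isCompact_closedFace _).image continuous_cover).isClosed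
    · intro h
      have : S = ⋃ α, S ∩ Set.range ((coxeterA n).complex.char α) := by
        rw [← Set.inter_iUnion, eq_comm, Set.inter_eq_left]
        intro p _
        obtain ⟨x, rfl⟩ := cover_surjective p
        obtain ⟨v, hv⟩ := exists_deck_point_cellOf x
        refine Set.mem_iUnion.2 ⟨cellOf x, ?_⟩
        rw [hrange]
        refine ⟨deck (-v) x, ?_, cover_deck _ _⟩
        rw [← deck_mem_closedFace v, deck_neg_deck, closedFace_eq hv]
        exact self_mem_closedFace x
      rw [this]
      exact isClosed_iUnion_of_finite h
  face α F hF := by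
    rw [polytope_eq] at hF
    obtain ⟨y, hy, rfl⟩ := exists_eq_closedFace hF
    obtain ⟨v, hv⟩ := exists_deck_point_cellOf y
    have h : deck v (point (cellOf y)) ∈ closedFace (point α) :=
      closedFace_subset hy (openFace_subset_closedFace y hv)
    refine ⟨cellOf y, (faceHomOfDeck v h).toFun, (faceHomOfDeck v h).isFaceMap,
      (faceHomOfDeck v h).char_comp, ?_⟩
    rw [← closedFace_eq hv, ← image_deck_closedFace, ← polytope_eq]
    ext z
    constructor
    · rintro ⟨x, rfl⟩
      exact ⟨x, x.2, rfl⟩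
    · rintro ⟨x, hx, rfl⟩
      exact ⟨⟨x, hx⟩, rfl⟩

end ToricArrangement

namespace ToricArrangement

variable {n : ℕ}

/-! ### The isomorphism of categories -/

/-- Compatibility with the covering makes the displacement of each point integral; it is continuous
on a convex, hence connected, polytope, so it is constant. -/
theorem exists_deck_of_faceHom {α β : (coxeterA n).complex.Cell}
    (φ : CellFamily.FaceHom (coxeterA n).complex β α) :
    ∃ v : Fin n → ℤ, ∀ y, (φ.toFun y : EuclideanSpace ℝ (Fin n)) = deck v y := by
  have h1 : ∀ y, ∃ v : Fin n → ℤ, (φ.toFun y : EuclideanSpace ℝ (Fin n)) = deck v y :=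
    fun y => exists_deck_of_cover_eq (φ.char_comp y).symm
  choose m hm using h1
  have hconn : PreconnectedSpace ((coxeterA n).complex.polytope β) := by
    rw [polytope_eq]
    exact Subtype.preconnectedSpace (convex_closedFace _).isPreconnected
  have hcont : ∀ k, Continuous fun y => m y k := by
    intro k
    rw [Int.isClosedEmbedding_coe_real.isEmbedding.continuous_iff]
    have : ((fun m : ℤ => (m : ℝ)) ∘ fun y => m y k) = fun y =>
        (EuclideanSpace.proj k : EuclideanSpace ℝ (Fin n) →L[ℝ] ℝ)
          ((φ.toFun y : EuclideanSpace ℝ (Fin n)) - y) := by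
      funext y
      simp [hm, deck]
    rw [this]
    have := φ.isFaceMap.isEmbedding.continuous
    fun_prop
  let y₀ : (coxeterA n).complex.polytope β := ⟨point β, mem_polytope.2 (self_mem_closedFace _)⟩
  refine ⟨m y₀, fun y => ?_⟩
  have : m y = m y₀ := funext fun k => PreconnectedSpace.constant hconn (hcont k)
  rw [hm, this]

/-- The integral vector by which a morphism of the face category translates. -/
noncomputable def shiftOf {α β : (coxeterA n).complex.Cell}
    (φ : CellFamily.FaceHom (coxeterA n).complex β α) : Fin n → ℤ :=
  Classical.choose (exists_deck_of_faceHom φ)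

theorem toFun_eq_deck {α β : (coxeterA n).complex.Cell}
    (φ : CellFamily.FaceHom (coxeterA n).complex β α) (y) :
    (φ.toFun y : EuclideanSpace ℝ (Fin n)) = deck (shiftOf φ) y :=
  Classical.choose_spec (exists_deck_of_faceHom φ) y

theorem deck_point_mem {α β : (coxeterA n).complex.Cell}
    (φ : CellFamily.FaceHom (coxeterA n).complex β α) :
    deck (shiftOf φ) (point β) ∈ closedFace (point α) := by
  rw [← toFun_eq_deck φ ⟨point β, mem_polytope.2 (self_mem_closedFace _)⟩]
  exact mem_polytope.1 (φ.toFun _).2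

theorem deck_left_injective (x : EuclideanSpace ℝ (Fin n)) {v w : Fin n → ℤ}
    (h : deck v x = deck w x) : v = w := by
  funext k
  have := congrArg (fun z : EuclideanSpace ℝ (Fin n) => z k) h
  simpa [deck] using this

theorem shiftOf_unique {α β : (coxeterA n).complex.Cell}
    (φ : CellFamily.FaceHom (coxeterA n).complex β α) {v : Fin n → ℤ}
    (h : ∀ y, (φ.toFun y : EuclideanSpace ℝ (Fin n)) = deck v y) : shiftOf φ = v := by
  have h1 := h ⟨point β, mem_polytope.2 (self_mem_closedFace _)⟩
  rw [toFun_eq_deck] at h1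
  exact deck_left_injective _ h1

theorem consZero_injective : Function.Injective (consZero (n := n)) := by
  intro v w h
  funext k
  exact congrFun h k.succ

theorem floorCocycle_le_shift {α β : (coxeterA n).complex.Cell} {v : Fin n → ℤ}
    (h : deck v (point β) ∈ closedFace (point α)) (i j : Fin (n + 1)) :
    floorCocycle (point α) i j ≤ (floorCocycle (point β)).shift (consZero v) i j := by
  rw [← floorCocycle_deck]
  exact h i j

/-- The functor from the face category to the category of cyclic partitions. -/
noncomputable def partitionFunctor (n : ℕ) :
    (coxeterA n).FaceCategory ⥤ CyclicPartition n where
  obj α := (floorCocycle (point α)).partition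
  map {β α} φ := FloorCocycle.homOfShift _ _ (consZero (shiftOf φ))
    (floorCocycle_le_shift (deck_point_mem φ))
  map_id α := CyclicPartition.Hom.ext (CyclicPartition.Hom.removed_eq_empty _)
  map_comp {γ β α} φ ψ := by
    refine FloorCocycle.homOfShift_comp _ _ _ _ _ _ _ _ _ fun i => ?_
    have : shiftOf (φ ≫ ψ) = shiftOf ψ + shiftOf φ := by
      refine shiftOf_unique _ fun y => ?_
      refine (toFun_eq_deck ψ (φ.toFun y)).trans
        ((congrArg (deck _) (toFun_eq_deck φ y)).trans ?_)
      ext k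
      simp [deck]
      ring
    rw [this]
    induction i using Fin.cases <;> simp [consZero]

instance (n : ℕ) : (partitionFunctor n).Faithful where
  map_injective {β α} φ ψ h := by
    have h1 : shiftOf φ = shiftOf ψ :=
      consZero_injective (FloorCocycle.homOfShift_injective _ _ _ _
        (floorCocycle_le_shift (deck_point_mem φ)) (floorCocycle_le_shift (deck_point_mem ψ)) rfl h)
    refine CellFamily.FaceHom.ext (funext fun y => Subtype.ext ?_)
    exact (toFun_eq_deck φ y).trans (h1 ▸ (toFun_eq_deck ψ y).symm)

instance (n : ℕ) : (partitionFunctor n).Full where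
  map_surjective {β α} f := by
    obtain ⟨V, h, hV0, rfl⟩ := FloorCocycle.exists_homOfShift_eq _ _ f
    have hV : consZero (fun k => V k.succ) = V := by
      funext i
      induction i using Fin.cases with
      | zero => simp [consZero, hV0]
      | succ k => simp [consZero]
    have hmem : deck (fun k => V k.succ) (point β) ∈ closedFace (point α) := by
      intro i j
      rw [floorCocycle_deck, hV]
      exact h i j
    refine ⟨faceHomOfDeck _ hmem, ?_⟩
    have hs : consZero (shiftOf (faceHomOfDeck _ hmem)) = V := by
      rw [shiftOf_unique (faceHomOfDeck _ hmem) fun y => rfl, hV]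
    apply CyclicPartition.Hom.ext
    simp only [partitionFunctor, FloorCocycle.homOfShift, hs]

instance (n : ℕ) : (partitionFunctor n).EssSurj where
  mem_essImage y := by
    obtain ⟨α, hα⟩ := partition_point_surjective y
    exact ⟨α, ⟨eqToIso hα⟩⟩

instance (n : ℕ) : (partitionFunctor n).IsEquivalence where

end ToricArrangement

theorem IsAcyclicCategory.hom_ext {C : Type} [SmallCategory C] (hC : IsAcyclicCategory C) {x y : C}
    (h : x = y) (f g : x ⟶ y) : f = g := by
  subst h
  rw [hC.endo_eq_id f, hC.endo_eq_id g]

/-- Isomorphic objects of an acyclic category are equal, so the counit gives equality of objects on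
one side, and injectivity of `F` on objects gives it on the other. Since parallel morphisms between
equal objects of `D` coincide, the units are the transport isomorphisms. -/
theorem nonempty_iso_of_isEquivalence {C D : Type} [SmallCategory C] [SmallCategory D]
    (hD : IsAcyclicCategory D) (F : C ⥤ D) [F.IsEquivalence] (hF : Function.Injective F.obj) :
    Nonempty (Cat.of C ≅ Cat.of D) := by
  let e := F.asEquivalence
  have h₂ : ∀ Y : D, e.functor.obj (e.inverse.obj Y) = Y := fun Y =>
    hD.eq_of_isIso (e.counitIso.hom.app Y) inferInstance
  have h₁ : ∀ X : C, e.inverse.obj (e.functor.obj X) = X := fun X => hF (h₂ (F.obj X))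
  exact ⟨Cat.isoOfEquiv (C := Cat.of C) (D := Cat.of D) e h₁ h₂
    (fun X => F.map_injective (hD.hom_ext (congrArg F.obj (h₁ X).symm) _ _))
    fun Y => hD.hom_ext (h₂ Y) _ _⟩

theorem mainTheorem7 (n : ℕ) :
    (ToricArrangement.coxeterA n).complex.IsPolyhedralCW ∧
    IsAcyclicCategory (CyclicPartition n) ∧
    Nonempty (Cat.of (ToricArrangement.coxeterA n).FaceCategory ≅ Cat.of (CyclicPartition n)) ∧
    ∀ y : CyclicPartition n,
      Nat.card (CyclicPartition.oneBlock n ⟶ y) = Nat.card y.Block :=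
  ⟨ToricArrangement.isPolyhedralCW_coxeterA n, CyclicPartition.isAcyclicCategory n,
    nonempty_iso_of_isEquivalence (CyclicPartition.isAcyclicCategory n)
      (ToricArrangement.partitionFunctor n) ToricArrangement.partition_point_injective,
    CyclicPartition.card_oneBlock_hom⟩
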